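/- Let $k$ be a field and let $I=\{i(1),\dots,i(d)\}$ be a finite poset in which any two elements $i,j$ have a minimum (greatest lower bound) $i\cap j$; the numbering of $I$ is arbitrary. Let $A=(A_i,\phi_{ij})$ be an NC scheme over $I$: unital associative, not necessarily commutative $k$-algebras $A_i$ $(i\in I)$ and $k$-algebra homomorphisms $\phi_{ij}:A_j\to A_i$ for $i<j$ (with $\phi_{ii}=\mathrm{id}$) such that $\phi_{ij}\phi_{jl}=\phi_{il}$ for $i<j<l$, such that $-\otimes_{A_j}A_i$ is exact on right $A_j$-modules for $i<j$, and such that multiplication $A_i\otimes_{A_j}A_i\to A_i$ is bijective for $i<j$. Assume moreover that $A_j\otimes_{A_l}A_m\to A_i$, $a\otimes b\mapsto\phi_{ij}(a)\phi_{im}(b)$, is bijective whenever $i=j\cap m$ and $j,m<l$. Let $\mathrm{Qcoh}(A)$ be the ($k$-linear, abelian) category of quasi-coherent modules $M=(M_i,\psi_{ij})$: right $A_i$-modules $M_i$ with isomorphisms of right $A_i$-modules $\psi_{ij}:M_j\otimes_{A_j}A_i\to M_i$ for $i<j$ such that $\psi_{ij}(\psi_{jl}\otimes_{A_j}A_i)=\psi_{il}$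 for $i<j<l$; morphisms are families of right $A_i$-linear maps compatible with the $\psi_{ij}$. Let $\mathrm{Hom}_A$ and $\mathrm{Ext}_A$ be taken in $\mathrm{Qcoh}(A)$. For $s\in I$ and a right $A_s$-module $M_s$, let $[M_s]\in\mathrm{Qcoh}(A)$ be given by $[M_s]_i=M_s\otimes_{A_s}A_{i\cap s}$, with gluing maps $m\otimes a\otimes b\mapsto m\otimes\phi_{pq}(a)\phi_{pi}(b)$ for $i<j$, $p=i\cap s$, $q=j\cap s$. For $M\in\mathrm{Qcoh}(A)$ and $s'\le s$ there is a natural map $[M_s]\to[M_{s'}]$, given at $i$ by $m\otimes a\mapsto\psi_{s's}(m\otimes1)\otimes\phi_{i\cap s',\,i\cap s}(a)$. The Čech complex $\check C^\bullet(M)$ has terms $$\check C^p(M)=\bigoplus_{1\le j_0<\dots<j_p\le d}[M_{i(j_0)\cap\dots\cap i(j_p)}]\qquad(p\ge 0),$$ and the component of its differential $\check C^{p}(M)\to\check C^{p+1}(M)$ at $j_0<\dots<j_{p+1}$ is $\sum_{a=0}^{p+1}(-1)^a$ times the natural map $[M_{\bigcap_{l\ne a}i(j_l)}]\to[M_{\bigcap_{l}i(j_l)}]$.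 Then for all $M,N\in\mathrm{Qcoh}(A)$ there is a first-quadrant cohomological spectral sequence of $k$-vector spaces $$E_1^{p,q}=\mathrm{Ext}^q_A(M,\check C^p(N))\Rightarrow\mathrm{Ext}^{p+q}_A(M,N),$$ whose differential $d_1$ is induced by the Čech differential. In particular, if $M$ is locally free of finite rank (there is an integer $r\ge0$ such that every $M_i$ is a free right $A_i$-module of rank $r$), then for all $p\ge0$ $$H^p(\mathrm{Hom}_A(M,\check C^\bullet(N)))\cong\mathrm{Ext}^p_A(M,N)$$ as $k$-vector spaces. -/

import Mathlib

universe w u v t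

namespace NC

open CategoryTheory CategoryTheory.Limits MulOpposite TensorProduct

/-! ### Tensor products over noncommutative rings -/

section BaseChange

variable {A B : Type u} [Ring A] [Ring B] (f : A →+* B)

/-- The relations `m a ⊗ b = m ⊗ f(a) b`.  Right modules are modules over the opposite ring;
`M ⊗ B` is written as `B ⊗[ℤ] M` because Mathlib lets scalars act on the first factor, and the set
of relations is stable under right multiplication by `B`. -/
def balancedRelations (M : Type u) [AddCommGroup M] [Module Aᵐᵒᵖ M] :
    Submodule Bᵐᵒᵖ (B ⊗[ℤ] M) :=
  Submodule.span Bᵐᵒᵖ {x | ∃ (m : M) (a : A) (b : B), x = b ⊗ₜ[ℤ] (op a • m) - (f a * b) ⊗ₜ[ℤ] m}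

/-- For a ring homomorphism `f : A → B` and a right `A`-module `M`, the right `B`-module
`M ⊗_A B`. -/
def BaseChange (M : Type u) [AddCommGroup M] [Module Aᵐᵒᵖ M] : Type u :=
  (B ⊗[ℤ] M) ⧸ balancedRelations f M

namespace BaseChange

variable (M : Type u) [AddCommGroup M] [Module Aᵐᵒᵖ M]

noncomputable instance : AddCommGroup (BaseChange f M) :=
  inferInstanceAs (AddCommGroup ((B ⊗[ℤ] M) ⧸ balancedRelations f M))

noncomputable instance : Module Bᵐᵒᵖ (BaseChange f M) :=
  inferInstanceAs (Module Bᵐᵒᵖ ((B ⊗[ℤ] M) ⧸ balancedRelations f M))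

variable {M}

/-- The element `m ⊗ b` of `M ⊗_A B`. -/
def tmul (m : M) (b : B) : BaseChange f M :=
  (balancedRelations f M).mkQ (b ⊗ₜ[ℤ] m)

variable {f}

lemma add_tmul (m m' : M) (b : B) : tmul f (m + m') b = tmul f m b + tmul f m' b :=
  (congrArg (balancedRelations f M).mkQ (TensorProduct.tmul_add b m m')).trans (map_add _ _ _)

lemma tmul_add (m : M) (b b' : B) : tmul f m (b + b') = tmul f m b + tmul f m b' :=
  (congrArg (balancedRelations f M).mkQ (TensorProduct.add_tmul b b' m)).trans (map_add _ _ _)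

lemma zero_tmul (b : B) : tmul f (0 : M) b = 0 :=
  (congrArg (balancedRelations f M).mkQ (TensorProduct.tmul_zero M b)).trans (map_zero _)

lemma smul_tmul (m : M) (a : A) (b : B) : tmul f (op a • m) b = tmul f m (f a * b) := by
  refine (Submodule.Quotient.eq _).2 (Submodule.subset_span ⟨m, a, b, rfl⟩)

lemma op_smul_tmul (m : M) (b c : B) : op c • tmul f m b = tmul f m (b * c) := by
  rfl

lemma tmul_eq (m : M) (b : B) : tmul f m b = op b • tmul f m 1 := by
  rw [op_smul_tmul, one_mul]

lemma induction_on {P : BaseChange f M → Prop} (x : BaseChange f M) (h0 : P 0)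
    (h1 : ∀ m b, P (tmul f m b)) (h2 : ∀ x y, P x → P y → P (x + y)) : P x := by
  obtain ⟨y, rfl⟩ := (balancedRelations f M).mkQ_surjective x
  induction y using TensorProduct.induction_on with
  | zero => exact h0
  | tmul b m => exact h1 m b
  | add y z hy hz => rw [map_add]; exact h2 _ _ hy hz

/-- Two additive maps out of `M ⊗_A B` agreeing on all `m ⊗ b` are equal. -/
lemma addHom_ext {P F : Type*} [AddCommGroup P] [FunLike F (BaseChange f M) P]
    [AddMonoidHomClass F (BaseChange f M) P] {g g' : F}
    (h : ∀ m b, g (tmul f m b) = g' (tmul f m b)) : g = g' := by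
  refine DFunLike.ext _ _ fun x => ?_
  induction x using induction_on with
  | h0 => simp
  | h1 m b => exact h m b
  | h2 x y hx hy => rw [map_add, map_add, hx, hy]

variable {N : Type u} [AddCommGroup N] [Module Bᵐᵒᵖ N]

/-- The map `m ⊗ b ↦ g(m) b` induced by an `A`-linear map `g : M → N` to a right `B`-module. -/
noncomputable def lift (g : M →+ N) (hg : ∀ (a : A) (m : M), g (op a • m) = op (f a) • g m) :
    BaseChange f M →ₗ[Bᵐᵒᵖ] N :=
  (balancedRelations f M).liftQ
    (TensorProduct.AlgebraTensorModule.lift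
      { toFun := fun b => (op b • g : M →+ N).toIntLinearMap
        map_add' := fun b b' => by ext m; simp [add_smul]
        map_smul' := fun c b => by ext m; simp [mul_smul] })
    (by
      refine Submodule.span_le.2 ?_
      rintro _ ⟨m, a, b, rfl⟩
      simp [hg, mul_smul])

@[simp]
lemma lift_tmul (g : M →+ N) (hg : ∀ (a : A) (m : M), g (op a • m) = op (f a) • g m) (m : M)
    (b : B) : lift g hg (tmul f m b) = op b • g m :=
  rfl

end BaseChange

/-- Restriction of scalars of right modules along `f : A → B`. -/
noncomputable abbrev restr : ModuleCat.{u} Bᵐᵒᵖ ⥤ ModuleCat.{u} Aᵐᵒᵖ :=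
  ModuleCat.restrictScalars (RingHom.op f)

/-- The functor `M ↦ M ⊗_A B` on right modules. -/
noncomputable def baseChange : ModuleCat.{u} Aᵐᵒᵖ ⥤ ModuleCat.{u} Bᵐᵒᵖ where
  obj M := ModuleCat.of Bᵐᵒᵖ (BaseChange f M)
  map {M N} g := ModuleCat.ofHom (BaseChange.lift
    { toFun := fun m => BaseChange.tmul f (g m) 1
      map_zero' := by simp [BaseChange.zero_tmul]
      map_add' := fun m m' => by simp [BaseChange.add_tmul] }
    (fun a m => by simp [BaseChange.smul_tmul, BaseChange.op_smul_tmul]))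
  map_id M := by
    refine ModuleCat.hom_ext (BaseChange.addHom_ext fun m b => ?_)
    simp [BaseChange.op_smul_tmul]
  map_comp g h := by
    refine ModuleCat.hom_ext (BaseChange.addHom_ext fun m b => ?_)
    simp [BaseChange.op_smul_tmul]

lemma baseChange_map_tmul {M N : ModuleCat.{u} Aᵐᵒᵖ} (g : M ⟶ N) (m : M) (b : B) :
    (baseChange f).map g (BaseChange.tmul f m b) = BaseChange.tmul f (g m) b := by
  refine (BaseChange.op_smul_tmul (f := f) (g m) 1 b).trans ?_
  rw [one_mul]

lemma baseChange_hom_ext {M : ModuleCat.{u} Aᵐᵒᵖ} {N : ModuleCat.{u} Bᵐᵒᵖ}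
    {g h : (baseChange f).obj M ⟶ N}
    (H : ∀ (m : M) (b : B), g (BaseChange.tmul f m b) = h (BaseChange.tmul f m b)) : g = h :=
  ModuleCat.hom_ext (BaseChange.addHom_ext H)

/-- Base change is left adjoint to restriction of scalars. -/
noncomputable def baseChangeAdj : baseChange f ⊣ restr f :=
  Adjunction.mkOfHomEquiv
    { homEquiv := fun M N =>
        { toFun := fun g => ModuleCat.ofHom (Y := (restr f).obj N)
            { toFun := fun m => g (BaseChange.tmul f m 1)
              map_add' := fun m m' => by
                rw [BaseChange.add_tmul]; exact map_add g.hom _ _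
              map_smul' := fun a m => by
                have h1 := BaseChange.smul_tmul (f := f) m a.unop 1
                have h2 := BaseChange.op_smul_tmul (f := f) m 1 (f a.unop)
                rw [one_mul] at h2
                rw [mul_one, ← h2] at h1
                exact (congrArg g h1).trans (map_smul g.hom _ _) }
          invFun := fun g => ModuleCat.ofHom (BaseChange.lift (N := N)
            (g.hom.toAddMonoidHom : M →+ N) (fun a m => map_smul g.hom (op a) m))
          left_inv := fun g => baseChange_hom_ext f fun m b => by
            refine (map_smul g.hom (op b) (BaseChange.tmul f m 1)).symm.trans ?_
            rw [BaseChange.op_smul_tmul, one_mul]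
            rfl
          right_inv := fun g => by
            refine ModuleCat.hom_ext (LinearMap.ext fun m => ?_)
            exact one_smul _ _ }
      homEquiv_naturality_left_symm := fun g h => by
        refine baseChange_hom_ext f fun m b => ?_
        exact (congrArg (fun x => (BaseChange.lift (N := _) (h.hom.toAddMonoidHom)
          (fun a m => map_smul h.hom (op a) m)) x) (baseChange_map_tmul f g m b)).symm
      homEquiv_naturality_right := fun g h => rfl }

lemma baseChangeAdj_homEquiv_apply {M : ModuleCat.{u} Aᵐᵒᵖ} {N : ModuleCat.{u} Bᵐᵒᵖ}
    (g : (baseChange f).obj M ⟶ N) (m : M) :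
    ((baseChangeAdj f).homEquiv M N g) m = g (BaseChange.tmul f m 1) := by
  simp only [baseChangeAdj, Adjunction.mkOfHomEquiv_homEquiv]
  rfl

instance : (baseChange f).IsLeftAdjoint := ⟨_, ⟨baseChangeAdj f⟩⟩

instance : (baseChange f).Additive where
  map_add {M N g h} := baseChange_hom_ext f fun m b => by
    rw [baseChange_map_tmul]
    exact (BaseChange.add_tmul _ _ _).trans (congrArg₂ (· + ·)
      (baseChange_map_tmul f g m b).symm (baseChange_map_tmul f h m b).symm)

/-- `B` is flat as a left `A`-module: `- ⊗_A B` preserves injections of right `A`-modules. -/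
def IsFlat : Prop :=
  ∀ ⦃M N : ModuleCat.{u} Aᵐᵒᵖ⦄ (g : M ⟶ N), Function.Injective g →
    Function.Injective ((baseChange f).map g)

lemma IsFlat.preservesFiniteLimits {f : A →+* B} (hf : IsFlat f) :
    PreservesFiniteLimits (baseChange f) := by
  have : (baseChange f).PreservesMonomorphisms := ⟨fun g hg => by
    rw [ModuleCat.mono_iff_injective] at hg ⊢
    exact hf g hg⟩
  have : (baseChange f).PreservesHomology :=
    (baseChange f).preservesHomology_of_preservesMonos_and_cokernels
  exact (baseChange f).preservesFiniteLimits_of_preservesHomology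

end BaseChange

/-- For a commutative square of rings `L → J → D`, `L → K → D`, the map `J ⊗_L K → D`,
`x ⊗ y ↦ g(x) g'(y)`. -/
noncomputable def mulMap {L J K D : Type u} [Ring L] [Ring J] [Ring K] [Ring D]
    (f : L →+* J) (f' : L →+* K) (g : J →+* D) (g' : K →+* D) (h : g.comp f = g'.comp f') :
    BaseChange f' ((restr f).obj (ModuleCat.of Jᵐᵒᵖ J)) →+ D :=
  (BaseChange.lift (f := f') (M := (restr f).obj (ModuleCat.of Jᵐᵒᵖ J))
    (N := (restr g').obj (ModuleCat.of Dᵐᵒᵖ D)) (g : J →+ D)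
    (fun a (x : J) => (map_mul g x (f a)).trans
      (congrArg (g x * ·) (RingHom.congr_fun h a)))).toAddMonoidHom

lemma mulMap_tmul {L J K D : Type u} [Ring L] [Ring J] [Ring K] [Ring D]
    (f : L →+* J) (f' : L →+* K) (g : J →+* D) (g' : K →+* D) (h : g.comp f = g'.comp f')
    (x : J) (y : K) :
    mulMap f f' g g' h
      (BaseChange.tmul f' (M := (restr f).obj (ModuleCat.of Jᵐᵒᵖ J)) x y) = g x * g' y :=
  rfl

/-! ### NC schemes and quasi-coherent modules -/

/-- An NC scheme over a poset `I` with binary minima.  The gluing homomorphisms are indexed by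
`i ≤ j`, with `φ_ii = id`; all conditions are automatic for `i = j`. -/
structure NCScheme (k : Type t) [Field k] (I : Type w) [SemilatticeInf I] where
  A : I → Type u
  [ring : ∀ i, Ring (A i)]
  [algebra : ∀ i, Algebra k (A i)]
  /-- the gluing homomorphism `φ_ij : A_j → A_i` -/
  φ : ∀ {i j : I}, i ≤ j → (A j →ₐ[k] A i)
  φ_refl : ∀ i, φ (le_refl i) = AlgHom.id k (A i)
  /-- cocycle condition -/
  φ_comp : ∀ {i j l : I} (hij : i ≤ j) (hjl : j ≤ l), (φ hij).comp (φ hjl) = φ (hij.trans hjl)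
  /-- `A_i` is flat as a left `A_j`-module -/
  flat : ∀ {i j : I} (h : i ≤ j), IsFlat (φ h : A j →+* A i)
  /-- multiplication `A_i ⊗_{A_j} A_i → A_i` is bijective -/
  birational : ∀ {i j : I} (h : i ≤ j), Function.Bijective
    (mulMap (φ h : A j →+* A i) (φ h : A j →+* A i) (RingHom.id (A i)) (RingHom.id (A i)) rfl)

attribute [instance] NCScheme.ring NCScheme.algebra

section

variable {k : Type t} [Field k] {I : Type w} [SemilatticeInf I]

namespace NCScheme

variable (X : NCScheme.{w, u, t} k I)

/-- The ring homomorphism underlying `φ_ij : A_j → A_i`. -/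
abbrev ρ {i j : I} (h : i ≤ j) : X.A j →+* X.A i := (X.φ h : X.A j →+* X.A i)

lemma ρ_refl (i : I) (a : X.A i) : X.ρ (le_refl i) a = a :=
  DFunLike.congr_fun (X.φ_refl i) a

lemma ρ_ρ {i j l : I} (hij : i ≤ j) (hjl : j ≤ l) (a : X.A l) :
    X.ρ hij (X.ρ hjl a) = X.ρ (hij.trans hjl) a :=
  DFunLike.congr_fun (X.φ_comp hij hjl) a

lemma ρ_comp_ρ {i j j' l : I} (hij : i ≤ j) (hjl : j ≤ l) (hij' : i ≤ j') (hjl' : j' ≤ l) :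
    (X.ρ hij).comp (X.ρ hjl) = (X.ρ hij').comp (X.ρ hjl') := by
  ext a
  exact (X.ρ_ρ hij hjl a).trans (X.ρ_ρ hij' hjl' a).symm

/-- The condition that `A_j ⊗_{A_l} A_p → A_i`, `a ⊗ b ↦ φ_ij(a) φ_ip(b)`, is bijective whenever
`i = j ∩ p` and `j, p ≤ l`.  (For `j = l` or `p = l` this is automatic.) -/
class HasInter : Prop where
  bijective : ∀ {i j p l : I} (hij : i ≤ j) (hip : i ≤ p) (hj : j ≤ l) (hp : p ≤ l), i = j ⊓ p →
    Function.Bijective (mulMap (X.ρ hj) (X.ρ hp) (X.ρ hij) (X.ρ hip) (X.ρ_comp_ρ _ _ _ _))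

end NCScheme

/-- A quasi-coherent module on an NC scheme.  As for `φ`, the gluing isomorphisms are
indexed by `i ≤ j`, where `ψ_ii` is the canonical isomorphism `M_i ⊗_{A_i} A_i ≅ M_i`. -/
structure Qcoh (X : NCScheme.{w, u, t} k I) where
  /-- the right `A_i`-module `M_i` -/
  obj : ∀ i : I, ModuleCat.{u} (X.A i)ᵐᵒᵖ
  /-- the gluing isomorphism `ψ_ij : M_j ⊗_{A_j} A_i ≅ M_i` -/
  ψ : ∀ {i j : I} (h : i ≤ j), (baseChange (X.ρ h)).obj (obj j) ≅ obj i
  ψ_refl : ∀ (i : I) (m : obj i) (a : X.A i),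
    (ψ (le_refl i)).hom (BaseChange.tmul (X.ρ (le_refl i)) m a) = op a • m
  /-- cocycle condition `ψ_ij (ψ_jl ⊗ A_i) = ψ_il` -/
  ψ_comp : ∀ {i j l : I} (hij : i ≤ j) (hjl : j ≤ l) (m : obj l) (a : X.A j) (b : X.A i),
    (ψ hij).hom (BaseChange.tmul (X.ρ hij) ((ψ hjl).hom (BaseChange.tmul (X.ρ hjl) m a)) b) =
      (ψ (hij.trans hjl)).hom (BaseChange.tmul (X.ρ (hij.trans hjl)) m (X.ρ hij a * b))

namespace Qcoh

variable {X : NCScheme.{w, u, t} k I}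

/-- A homomorphism of quasi-coherent modules: a family of right `A_i`-linear maps compatible
with the gluing isomorphisms. -/
@[ext]
structure Hom (M N : Qcoh X) where
  app : ∀ i : I, M.obj i ⟶ N.obj i
  comm : ∀ {i j : I} (h : i ≤ j),
    (baseChange (X.ρ h)).map (app j) ≫ (N.ψ h).hom = (M.ψ h).hom ≫ app i

lemma Hom.comm_assoc {M N : Qcoh X} (f : Hom M N) {i j : I} (h : i ≤ j)
    {Z : ModuleCat.{u} (X.A i)ᵐᵒᵖ} (g : N.obj i ⟶ Z) :
    (baseChange (X.ρ h)).map (f.app j) ≫ (N.ψ h).hom ≫ g = (M.ψ h).hom ≫ f.app i ≫ g := by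
  rw [← Category.assoc, f.comm h, Category.assoc]

instance : Category (Qcoh X) where
  Hom := Hom
  id M := { app := fun i => 𝟙 _, comm := by simp }
  comp f g :=
    { app := fun i => f.app i ≫ g.app i
      comm := fun h => by simp [g.comm h, f.comm_assoc h] }

@[simp] lemma id_app (M : Qcoh X) (i : I) : Hom.app (𝟙 M) i = 𝟙 _ := rfl

@[simp] lemma comp_app {M N P : Qcoh X} (f : M ⟶ N) (g : N ⟶ P) (i : I) :
    (f ≫ g).app i = f.app i ≫ g.app i := rfl

@[ext]
lemma hom_ext {M N : Qcoh X} {f g : M ⟶ N} (h : ∀ i, f.app i = g.app i) : f = g :=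
  Hom.ext (funext h)

/-! The `k`-linear structure is componentwise, where `c ∈ k` acts on `M_i` through `k → A_i`. -/

lemma baseChange_map_smul {A B : Type u} [Ring A] [Ring B] [Algebra k A] [Algebra k B]
    (f : A →ₐ[k] B) {M N : ModuleCat.{u} Aᵐᵒᵖ} (g : M ⟶ N) (c : k) :
    (baseChange (f : A →+* B)).map (c • g) = c • (baseChange (f : A →+* B)).map g := by
  refine baseChange_hom_ext _ fun m b => ?_
  rw [baseChange_map_tmul]
  have h1 : (c • g) m = op (algebraMap k A c) • g m := rfl
  have h2 : ∀ x : (baseChange (f : A →+* B)).obj M, (c • (baseChange (f : A →+* B)).map g) x =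
    op (algebraMap k B c) • (baseChange (f : A →+* B)).map g x := fun _ => rfl
  refine ((congrArg (fun y => BaseChange.tmul (f : A →+* B) y b) h1).trans ?_).trans
    ((h2 _).trans (congrArg _ (baseChange_map_tmul _ g m b))).symm
  refine (BaseChange.smul_tmul _ _ _).trans
    (Eq.trans ?_ (BaseChange.op_smul_tmul (f := (f : A →+* B)) (g m) b _).symm)
  congr 1
  have : (f : A →+* B) (algebraMap k A c) = algebraMap k B c := f.commutes c
  rw [this, Algebra.commutes]

section

variable (M N : Qcoh X)

instance : Zero (M ⟶ N) := ⟨{ app := fun i => 0, comm := by simp }⟩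
instance : Add (M ⟶ N) := ⟨fun f g =>
  { app := fun i => f.app i + g.app i, comm := fun h => by
      simp [Functor.map_add, f.comm h, g.comm h] }⟩
instance : Neg (M ⟶ N) := ⟨fun f =>
  { app := fun i => - f.app i, comm := fun h => by simp [Functor.map_neg, f.comm h] }⟩
instance : Sub (M ⟶ N) := ⟨fun f g =>
  { app := fun i => f.app i - g.app i, comm := fun h => by
      simp [Functor.map_sub, f.comm h, g.comm h] }⟩
instance : SMul ℕ (M ⟶ N) := ⟨fun n f =>
  { app := fun i => n • f.app i, comm := fun h => by simp [f.comm h] }⟩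
instance : SMul ℤ (M ⟶ N) := ⟨fun n f =>
  { app := fun i => n • f.app i, comm := fun h => by simp [f.comm h] }⟩
instance : SMul k (M ⟶ N) := ⟨fun c f =>
  { app := fun i => c • f.app i, comm := fun h => by
      rw [baseChange_map_smul, Linear.smul_comp, Linear.comp_smul, f.comm h] }⟩

lemma app_injective : Function.Injective (fun (f : M ⟶ N) => f.app) := fun _ _ h =>
  Hom.ext h

instance : AddCommGroup (M ⟶ N) :=
  (app_injective M N).addCommGroup _ rfl (fun _ _ => rfl) (fun _ => rfl) (fun _ _ => rfl)
    (fun _ _ => rfl) (fun _ _ => rfl)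

/-- The components of a homomorphism, as an additive map. -/
def appHom : (M ⟶ N) →+ (∀ i, M.obj i ⟶ N.obj i) where
  toFun f := f.app
  map_zero' := rfl
  map_add' _ _ := rfl

instance : Module k (M ⟶ N) :=
  Function.Injective.module k (appHom M N) (app_injective M N) (fun _ _ => rfl)

end

instance : Preadditive (Qcoh X) where
  add_comp _ _ _ f f' g := hom_ext fun i => Preadditive.add_comp _ _ _ (f.app i) (f'.app i) (g.app i)
  comp_add _ _ _ f g g' := hom_ext fun i => Preadditive.comp_add _ _ _ (f.app i) (g.app i) (g'.app i)

instance : Linear k (Qcoh X) where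
  smul_comp _ _ _ c f g := hom_ext fun i => Linear.smul_comp _ _ _ c (f.app i) (g.app i)
  comp_smul _ _ _ f c g := hom_ext fun i => Linear.comp_smul _ _ _ (f.app i) c (g.app i)

@[simp] lemma zero_app (M N : Qcoh X) (i : I) : (0 : M ⟶ N).app i = 0 := rfl
@[simp] lemma add_app {M N : Qcoh X} (f g : M ⟶ N) (i : I) :
    (f + g).app i = f.app i + g.app i := rfl

/-- The functor `M ↦ M_i`. -/
@[simps]
def ev (X : NCScheme.{w, u, t} k I) (i : I) : Qcoh X ⥤ ModuleCat.{u} (X.A i)ᵐᵒᵖ where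
  obj M := M.obj i
  map f := f.app i

instance (i : I) : (ev X i).Additive where

end Qcoh

end


namespace Qcoh

/-! ### `Qcoh X` is abelian, with kernels and cokernels computed componentwise -/

section Abelian

variable {k : Type t} [Field k] {I : Type w} [SemilatticeInf I] {X : NCScheme.{w, u, t} k I}

instance {i j : I} (h : i ≤ j) : PreservesFiniteLimits (baseChange (X.ρ h)) :=
  (X.flat h).preservesFiniteLimits

set_option linter.unusedSectionVars false

variable {J : Type} [SmallCategory J] (K : J ⥤ Qcoh X)

/-- The gluing isomorphisms of a diagram of quasi-coherent modules. -/
noncomputable def ψNatIso {i j : I} (h : i ≤ j) :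
    (K ⋙ ev X j) ⋙ baseChange (X.ρ h) ≅ K ⋙ ev X i :=
  NatIso.ofComponents (fun c => (K.obj c).ψ h) (fun f => (K.map f).comm h)

lemma ψNatIso_hom_app {i j : I} (h : i ≤ j) (c : J) :
    (ψNatIso K h).hom.app c = ((K.obj c).ψ h).hom := rfl

variable [FinCategory J]

/-- The gluing isomorphism on a componentwise limit. -/
noncomputable def limψ {i j : I} (h : i ≤ j) :
    (baseChange (X.ρ h)).obj (limit (K ⋙ ev X j)) ≅ limit (K ⋙ ev X i) :=
  preservesLimitIso (baseChange (X.ρ h)) (K ⋙ ev X j) ≪≫ HasLimit.isoOfNatIso (ψNatIso K h)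

lemma limψ_π {i j : I} (h : i ≤ j) (c : J) :
    (limψ K h).hom ≫ limit.π (K ⋙ ev X i) c =
      (baseChange (X.ρ h)).map (limit.π (K ⋙ ev X j) c) ≫ ((K.obj c).ψ h).hom := by
  simp only [limψ, Iso.trans_hom, Category.assoc, HasLimit.isoOfNatIso_hom_π, ψNatIso_hom_app]
  exact preservesLimitIso_hom_π_assoc _ _ _ _

lemma limψ_π_apply {i j : I} (h : i ≤ j) (c : J) (m : ↑(limit (K ⋙ ev X j))) (a : X.A i) :
    limit.π (K ⋙ ev X i) c ((limψ K h).hom (BaseChange.tmul (X.ρ h) m a)) =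
      ((K.obj c).ψ h).hom (BaseChange.tmul (X.ρ h) (limit.π (K ⋙ ev X j) c m) a) := by
  refine (ConcreteCategory.congr_hom (limψ_π K h c) (BaseChange.tmul (X.ρ h) m a)).trans ?_
  exact congrArg ((K.obj c).ψ h).hom (baseChange_map_tmul _ _ _ _)

/-- The componentwise limit. -/
noncomputable def lim : Qcoh X where
  obj i := limit (K ⋙ ev X i)
  ψ h := limψ K h
  ψ_refl i m a := by
    refine Concrete.limit_ext _ _ _ fun c => ?_
    rw [limψ_π_apply]
    exact ((K.obj c).ψ_refl i _ a).trans (map_smul (limit.π (K ⋙ ev X i) c).hom (op a) m).symm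
  ψ_comp hij hjl m a b := by
    refine Concrete.limit_ext _ _ _ fun c => ?_
    rw [limψ_π_apply, limψ_π_apply, limψ_π_apply]
    exact (K.obj c).ψ_comp hij hjl _ a b

/-- The components of the morphism to the limit induced by a cone. -/
noncomputable def liftApp (s : Cone K) (i : I) : s.pt.obj i ⟶ limit (K ⋙ ev X i) :=
  limit.lift (K ⋙ ev X i) ((ev X i).mapCone s)

lemma liftApp_π (s : Cone K) (i : I) (c : J) :
    liftApp K s i ≫ limit.π (K ⋙ ev X i) c = (s.π.app c).app i :=
  limit.lift_π ((ev X i).mapCone s) c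

lemma liftApp_comm (s : Cone K) {i j : I} (h : i ≤ j) :
    (baseChange (X.ρ h)).map (liftApp K s j) ≫ (limψ K h).hom =
      (s.pt.ψ h).hom ≫ liftApp K s i := by
  refine limit.hom_ext fun c => ?_
  have h2 : (baseChange (X.ρ h)).map ((s.π.app c).app j) ≫ ((K.obj c).ψ h).hom =
    (s.pt.ψ h).hom ≫ (s.π.app c).app i := (s.π.app c).comm h
  rw [Category.assoc, limψ_π, Category.assoc, liftApp_π]
  refine Eq.trans ?_ h2
  rw [← liftApp_π K s j c]
  exact (Functor.map_comp_assoc _ (liftApp K s j) (limit.π (K ⋙ ev X j) c) _).symm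

/-- The limit cone. -/
noncomputable def limCone : Cone K where
  pt := lim K
  π :=
    { app := fun c => { app := fun i => limit.π (K ⋙ ev X i) c, comm := fun h => (limψ_π K h c).symm }
      naturality := fun c c' f => by
        refine hom_ext fun i => ?_
        exact (limit.cone (K ⋙ ev X i)).π.naturality f }

/-- The limit cone is a limit. -/
noncomputable def limConeIsLimit : IsLimit (limCone K) where
  lift s :=
    { app := liftApp K s
      comm := liftApp_comm K s }
  fac s c := hom_ext fun i => limit.lift_π ((ev X i).mapCone s) c
  uniq s m hm := hom_ext fun i => by
    refine limit.hom_ext fun c => ?_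
    refine Eq.trans ?_ (limit.lift_π ((ev X i).mapCone s) c).symm
    exact congrArg (fun f => Hom.app f i) (hm c)

instance : HasLimit K := ⟨⟨_, limConeIsLimit K⟩⟩

instance (i : I) : PreservesLimit K (ev X i) :=
  preservesLimit_of_preserves_limit_cone (limConeIsLimit K)
    (IsLimit.ofIsoLimit (limit.isLimit (K ⋙ ev X i)) (Cone.ext (Iso.refl _)))

/-- The gluing isomorphism on a componentwise colimit. -/
noncomputable def colimψ {i j : I} (h : i ≤ j) :
    (baseChange (X.ρ h)).obj (colimit (K ⋙ ev X j)) ≅ colimit (K ⋙ ev X i) :=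
  preservesColimitIso (baseChange (X.ρ h)) (K ⋙ ev X j) ≪≫ HasColimit.isoOfNatIso (ψNatIso K h)

lemma colimψ_ι {i j : I} (h : i ≤ j) (c : J) :
    (baseChange (X.ρ h)).map (colimit.ι (K ⋙ ev X j) c) ≫ (colimψ K h).hom =
      ((K.obj c).ψ h).hom ≫ colimit.ι (K ⋙ ev X i) c := by
  simp only [colimψ, Iso.trans_hom, ι_preservesColimitIso_hom_assoc,
    HasColimit.isoOfNatIso_ι_hom, ψNatIso_hom_app]
  rfl

lemma colimψ_ι_apply {i j : I} (h : i ≤ j) (c : J) (m : (K.obj c).obj j) (a : X.A i) :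
    (colimψ K h).hom (BaseChange.tmul (X.ρ h) (colimit.ι (K ⋙ ev X j) c m) a) =
      colimit.ι (K ⋙ ev X i) c (((K.obj c).ψ h).hom (BaseChange.tmul (X.ρ h) m a)) := by
  refine Eq.trans ?_ (ConcreteCategory.congr_hom (colimψ_ι K h c) (BaseChange.tmul (X.ρ h) m a))
  exact congrArg (colimψ K h).hom (baseChange_map_tmul _ _ _ _).symm

/-- Elements of a colimit of modules are sums of elements coming from the diagram. -/
lemma colimit_induction {R : Type u} [Ring R] (F : J ⥤ ModuleCat.{u} R)
    {P : ↑(colimit F) → Prop} (h0 : P 0) (hadd : ∀ x y, P x → P y → P (x + y))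
    (hι : ∀ (c : J) (y : F.obj c), P (colimit.ι F c y)) (x : ↑(colimit F)) : P x := by
  let S : Submodule R ↑(colimit F) := ⨆ c, LinearMap.range (colimit.ι F c).hom
  have hS : ModuleCat.ofHom S.mkQ = 0 := by
    refine colimit.hom_ext fun c => ModuleCat.hom_ext (LinearMap.ext fun y => ?_)
    have : (colimit.ι F c).hom y ∈ S :=
      Submodule.mem_iSup_of_mem (p := fun c => LinearMap.range (colimit.ι F c).hom) c ⟨y, rfl⟩
    exact (Submodule.Quotient.mk_eq_zero S).2 this
  have hx : x ∈ S := (Submodule.Quotient.mk_eq_zero S).1 (ConcreteCategory.congr_hom hS x)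
  refine Submodule.iSup_induction (motive := P) (fun c => LinearMap.range (colimit.ι F c).hom) hx
    ?_ h0 hadd
  rintro c _ ⟨y, rfl⟩
  exact hι c y

/-- The componentwise colimit. -/
noncomputable def colim : Qcoh X where
  obj i := colimit (K ⋙ ev X i)
  ψ h := colimψ K h
  ψ_refl i m a := by
    induction m using colimit_induction with
    | h0 => rw [BaseChange.zero_tmul, smul_zero]; exact map_zero (colimψ K _).hom.hom
    | hadd x y hx hy =>
      rw [BaseChange.add_tmul, smul_add, ← hx, ← hy]; exact map_add (colimψ K _).hom.hom _ _
    | hι c y =>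
      refine (colimψ_ι_apply K _ c y a).trans ?_
      exact (congrArg _ ((K.obj c).ψ_refl i y a)).trans
        (map_smul (colimit.ι (K ⋙ ev X i) c).hom (op a) y)
  ψ_comp {i j l} hij hjl m a b := by
    induction m using colimit_induction with
    | h0 =>
      have h := map_zero (colimψ K hjl).hom.hom
      have h' := map_zero (colimψ K hij).hom.hom
      have h'' := map_zero (colimψ K (hij.trans hjl)).hom.hom
      rw [BaseChange.zero_tmul, BaseChange.zero_tmul]
      refine Eq.trans ?_ h''.symm
      refine Eq.trans (congrArg _ ((congrArg (fun z => BaseChange.tmul (X.ρ hij) z b) h).trans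
        (BaseChange.zero_tmul b))) h'
    | hadd x y hx hy =>
      have h := map_add (colimψ K hjl).hom.hom (BaseChange.tmul (X.ρ hjl) x a)
        (BaseChange.tmul (X.ρ hjl) y a)
      rw [BaseChange.add_tmul, BaseChange.add_tmul]
      refine Eq.trans ?_ (map_add (colimψ K (hij.trans hjl)).hom.hom _ _).symm
      refine Eq.trans (congrArg _ ((congrArg (fun z => BaseChange.tmul (X.ρ hij) z b) h).trans
        (BaseChange.add_tmul _ _ b))) ?_
      exact (map_add (colimψ K hij).hom.hom _ _).trans (congrArg₂ (· + ·) hx hy)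
    | hι c y =>
      refine Eq.trans (congrArg (fun z => (colimψ K hij).hom (BaseChange.tmul (X.ρ hij) z b))
        (colimψ_ι_apply K hjl c y a)) ?_
      refine (colimψ_ι_apply K hij c _ b).trans ?_
      refine Eq.trans ?_ (colimψ_ι_apply K (hij.trans hjl) c y _).symm
      exact congrArg _ ((K.obj c).ψ_comp hij hjl _ a b)

/-- The components of the morphism from the colimit induced by a cocone. -/
noncomputable def descApp (s : Cocone K) (i : I) : colimit (K ⋙ ev X i) ⟶ s.pt.obj i :=
  colimit.desc (K ⋙ ev X i) ((ev X i).mapCocone s)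

lemma ι_descApp (s : Cocone K) (i : I) (c : J) :
    colimit.ι (K ⋙ ev X i) c ≫ descApp K s i = (s.ι.app c).app i :=
  colimit.ι_desc ((ev X i).mapCocone s) c

lemma descApp_comm (s : Cocone K) {i j : I} (h : i ≤ j) :
    (baseChange (X.ρ h)).map (descApp K s j) ≫ (s.pt.ψ h).hom =
      (colimψ K h).hom ≫ descApp K s i := by
  rw [← cancel_epi ((preservesColimitIso (baseChange (X.ρ h)) (K ⋙ ev X j)).inv)]
  refine colimit.hom_ext fun c => ?_
  rw [ι_preservesColimitIso_inv_assoc, ι_preservesColimitIso_inv_assoc]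
  have h1 := colimψ_ι K h c
  have h2 : (baseChange (X.ρ h)).map ((s.ι.app c).app j) ≫ (s.pt.ψ h).hom =
    ((K.obj c).ψ h).hom ≫ (s.ι.app c).app i := (s.ι.app c).comm h
  rw [← Functor.map_comp_assoc, ι_descApp, reassoc_of% h1]
  exact h2.trans ((congrArg (((K.obj c).ψ h).hom ≫ ·) (ι_descApp K s i c).symm).trans
    (Category.assoc _ _ _).symm)

/-- The colimit cocone. -/
noncomputable def colimCocone : Cocone K where
  pt := colim K
  ι :=
    { app := fun c => { app := fun i => colimit.ι (K ⋙ ev X i) c, comm := fun h => colimψ_ι K h c }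
      naturality := fun c c' f => by
        refine hom_ext fun i => ?_
        exact (colimit.cocone (K ⋙ ev X i)).ι.naturality f }

/-- The colimit cocone is a colimit. -/
noncomputable def colimCoconeIsColimit : IsColimit (colimCocone K) where
  desc s :=
    { app := descApp K s
      comm := descApp_comm K s }
  fac s c := hom_ext fun i => colimit.ι_desc ((ev X i).mapCocone s) c
  uniq s m hm := hom_ext fun i => by
    refine colimit.hom_ext fun c => ?_
    refine Eq.trans ?_ (colimit.ι_desc ((ev X i).mapCocone s) c).symm
    exact congrArg (fun f => Hom.app f i) (hm c)

instance : HasColimit K := ⟨⟨_, colimCoconeIsColimit K⟩⟩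

instance (i : I) : PreservesColimit K (ev X i) :=
  preservesColimit_of_preserves_colimit_cocone (colimCoconeIsColimit K)
    (IsColimit.ofIsoColimit (colimit.isColimit (K ⋙ ev X i)) (Cocone.ext (Iso.refl _)))

end Abelian

section

variable {k : Type t} [Field k] {I : Type w} [SemilatticeInf I] {X : NCScheme.{w, u, t} k I}

instance : HasFiniteLimits (Qcoh X) := ⟨fun _ _ _ => ⟨fun _ => inferInstance⟩⟩
instance : HasFiniteColimits (Qcoh X) := ⟨fun _ _ _ => ⟨fun _ => inferInstance⟩⟩
instance (i : I) : PreservesFiniteLimits (ev X i) := ⟨fun _ _ _ => ⟨inferInstance⟩⟩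
instance (i : I) : PreservesFiniteColimits (ev X i) := ⟨fun _ _ _ => ⟨inferInstance⟩⟩

lemma isIso_of_app {M N : Qcoh X} (f : M ⟶ N) (h : ∀ i, IsIso (f.app i)) : IsIso f :=
  ⟨{ app := fun i => inv (f.app i)
     comm := fun hij => by
      rw [← cancel_epi ((baseChange _).map (f.app _)), ← Functor.map_comp_assoc,
        IsIso.hom_inv_id, CategoryTheory.Functor.map_id, Category.id_comp, f.comm_assoc,
        IsIso.hom_inv_id, Category.comp_id] },
    hom_ext fun i => IsIso.hom_inv_id (f.app i), hom_ext fun i => IsIso.inv_hom_id (f.app i)⟩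

instance {M N : Qcoh X} (f : M ⟶ N) : IsIso (Abelian.coimageImageComparison f) := by
  refine isIso_of_app _ fun i => ?_
  have := IsIso.of_isIso_fac_right
    (Abelian.PreservesCoimage.hom_coimageImageComparison (ev X i) f).symm
  exact this

/-- The category of quasi-coherent modules is abelian. -/
noncomputable instance : Abelian (Qcoh X) := Abelian.ofCoimageImageComparisonIsIso

end

end Qcoh


/-! ### The modules `[M_s]` -/

section

namespace BaseChange

variable {A B : Type u} [Ring A] [Ring B] {f : A →+* B} {M : Type u} [AddCommGroup M]
  [Module Aᵐᵒᵖ M]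

/-- An additive map out of `M ⊗_A B` from a balanced biadditive map. -/
noncomputable def liftAdd {P : Type u} [AddCommGroup P] (β : M →+ B →+ P)
    (hβ : ∀ (m : M) (a : A) (b : B), β (op a • m) b = β m (f a * b)) : BaseChange f M →+ P :=
  let L : B ⊗[ℤ] M →+ P := TensorProduct.liftAddHom β.flip
    (fun n b m => by
      rw [AddMonoidHom.flip_apply, AddMonoidHom.flip_apply, map_zsmul, map_zsmul]; rfl)
  QuotientAddGroup.lift (balancedRelations f M).toAddSubgroup L (by
    have key : ∀ x ∈ balancedRelations f M, ∀ c : Bᵐᵒᵖ, L (c • x) = 0 := by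
      intro x hx
      induction hx using Submodule.span_induction with
      | mem x hx =>
        obtain ⟨m, a, b, rfl⟩ := hx
        intro c
        rw [smul_sub, map_sub, sub_eq_zero]
        change β (op a • m) (b * c.unop) = β m (f a * b * c.unop)
        rw [hβ, mul_assoc]
      | zero => intro c; simp
      | add x y _ _ hx hy => intro c; rw [smul_add, map_add, hx, hy, add_zero]
      | smul a x _ hx => intro c; rw [← mul_smul]; exact hx _
    intro x hx
    have := key x hx 1
    rwa [one_smul] at this)

lemma liftAdd_tmul {P : Type u} [AddCommGroup P] (β : M →+ B →+ P)
    (hβ : ∀ (m : M) (a : A) (b : B), β (op a • m) b = β m (f a * b)) (m : M) (b : B) :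
    liftAdd β hβ (tmul f m b) = β m b :=
  rfl

/-- For `f : A → B`, `f' : A' → B'`, an additive map `r : M → M'` and `g : B → B'` with
`r(m a) ⊗ 1 = r(m) ⊗ g(f(a))`, the map `M ⊗_A B → M' ⊗_{A'} B'`, `m ⊗ b ↦ r(m) ⊗ g(b)`. -/
noncomputable def push {A A' B B' : Type u} [Ring A] [Ring A'] [Ring B] [Ring B'] (f : A →+* B)
    (f' : A' →+* B') {M M' : Type u} [AddCommGroup M] [Module Aᵐᵒᵖ M] [AddCommGroup M']
    [Module A'ᵐᵒᵖ M'] (r : M →+ M') (g : B →+* B')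
    (h : ∀ (m : M) (a : A), tmul f' (r (op a • m)) 1 = tmul f' (r m) (g (f a))) :
    BaseChange f M →+ BaseChange f' M' :=
  (lift (N := (restr g).obj (ModuleCat.of B'ᵐᵒᵖ (BaseChange f' M')))
    { toFun := fun m => (tmul f' (r m) 1 : BaseChange f' M')
      map_zero' := by rw [map_zero, zero_tmul]; rfl
      map_add' := fun m m' => by rw [map_add, add_tmul]; rfl }
    (fun a m => (h m a).trans (tmul_eq _ _))).toAddMonoidHom

section push

variable {A A' B B' : Type u} [Ring A] [Ring A'] [Ring B] [Ring B'] (f : A →+* B)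
    (f' : A' →+* B') {M M' : Type u} [AddCommGroup M] [Module Aᵐᵒᵖ M] [AddCommGroup M']
    [Module A'ᵐᵒᵖ M'] (r : M →+ M') (g : B →+* B')
    (h : ∀ (m : M) (a : A), tmul f' (r (op a • m)) 1 = tmul f' (r m) (g (f a)))

@[simp]
lemma push_tmul (m : M) (b : B) : push f f' r g h (tmul f m b) = tmul f' (r m) (g b) :=
  (tmul_eq _ _).symm

lemma push_smul (b : B) (x : BaseChange f M) :
    push f f' r g h (op b • x) = op (g b) • push f f' r g h x := by
  induction x using induction_on with
  | h0 => simp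
  | h1 m c => rw [op_smul_tmul, push_tmul, push_tmul, map_mul, op_smul_tmul]
  | h2 x y hx hy => rw [smul_add, map_add, map_add, smul_add, hx, hy]

end push

end BaseChange

end

namespace Qcoh

variable {k : Type t} [Field k] {I : Type w} [SemilatticeInf I] {X : NCScheme.{w, u, t} k I}

section Bracket

variable {s : I} (N : ModuleCat.{u} (X.A s)ᵐᵒᵖ)

/-- The module `[N]_i = N ⊗_{A_s} A_p` with `p = i ∩ s`, as a right `A_i`-module through
`φ_pi : A_i → A_p`. -/
noncomputable def bracketObj (i : I) : ModuleCat.{u} (X.A i)ᵐᵒᵖ :=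
  (restr (X.ρ (inf_le_left : i ⊓ s ≤ i))).obj
    ((baseChange (X.ρ (inf_le_right : i ⊓ s ≤ s))).obj N)

/-- The element `m ⊗ a` of `[N]_i`. -/
noncomputable def bracketTmul (i : I) (m : N) (a : X.A (i ⊓ s)) : bracketObj N i :=
  BaseChange.tmul (X.ρ (inf_le_right : i ⊓ s ≤ s)) m a

variable {N}

lemma bracketObj_smul (i : I) (m : N) (a : X.A (i ⊓ s)) (b : X.A i) :
    op b • bracketTmul N i m a = bracketTmul N i m (a * X.ρ inf_le_left b) := rfl

lemma bracketTmul_zero (i : I) (m : N) : bracketTmul N i m 0 = 0 := by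
  have := bracketObj_smul i m 0 0
  rw [zero_mul] at this
  rw [← this, MulOpposite.op_zero, zero_smul]

lemma bracketTmul_add (i : I) (m : N) (a b : X.A (i ⊓ s)) :
    bracketTmul N i m (a + b) = bracketTmul N i m a + bracketTmul N i m b :=
  BaseChange.tmul_add m a b

lemma bracketObj_induction {i : I} {P : bracketObj N i → Prop} (x : bracketObj N i) (h0 : P 0)
    (h1 : ∀ m a, P (bracketTmul N i m a)) (h2 : ∀ x y, P x → P y → P (x + y)) : P x :=
  BaseChange.induction_on (f := X.ρ (inf_le_right : i ⊓ s ≤ s)) x h0 h1 h2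

variable (N)

/-- The map `[N]_j → [N]_i`, `m ⊗ a ↦ m ⊗ φ_pq(a)`, where `p = i ∩ s` and `q = j ∩ s`. -/
noncomputable def bracketRes {i j : I} (h : i ≤ j) : bracketObj N j →+ bracketObj N i :=
  BaseChange.push _ _ (AddMonoidHom.id N) (X.ρ (inf_le_inf_right s h))
    (fun m a => (BaseChange.smul_tmul _ _ _).trans (by rw [mul_one, X.ρ_ρ]; rfl))

variable {N}

lemma bracketRes_tmul {i j : I} (h : i ≤ j) (m : N) (a : X.A (j ⊓ s)) :
    bracketRes N h (bracketTmul N j m a) = bracketTmul N i m (X.ρ (inf_le_inf_right s h) a) :=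
  BaseChange.push_tmul _ _ _ _ _ m a

lemma bracketRes_smul {i j : I} (h : i ≤ j) (a : X.A j) (x : bracketObj N j) :
    bracketRes N h (op a • x) = op (X.ρ h a) • bracketRes N h x := by
  induction x using bracketObj_induction with
  | h0 => simp
  | h1 m c =>
    rw [bracketObj_smul, bracketRes_tmul, bracketRes_tmul, bracketObj_smul, map_mul, X.ρ_ρ, X.ρ_ρ]
  | h2 x y hx hy => rw [smul_add, map_add, map_add, smul_add, hx, hy]

lemma bracketRes_refl (i : I) (x : bracketObj N i) : bracketRes N (le_refl i) x = x := by
  induction x using bracketObj_induction with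
  | h0 => simp
  | h1 m c => rw [bracketRes_tmul]; exact congrArg _ (X.ρ_refl _ c)
  | h2 x y hx hy => rw [map_add, hx, hy]

lemma bracketRes_comp {i j l : I} (hij : i ≤ j) (hjl : j ≤ l) (x : bracketObj N l) :
    bracketRes N hij (bracketRes N hjl x) = bracketRes N (hij.trans hjl) x := by
  induction x using bracketObj_induction with
  | h0 => simp
  | h1 m c => rw [bracketRes_tmul, bracketRes_tmul, bracketRes_tmul, X.ρ_ρ]
  | h2 x y hx hy => rw [map_add, map_add, map_add, hx, hy]

variable (N)

/-- The gluing map `[N]_j ⊗_{A_j} A_i → [N]_i`,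
`m ⊗ a ⊗ b ↦ m ⊗ φ_pq(a) φ_pi(b)`, where `p = i ∩ s` and `q = j ∩ s`. -/
noncomputable def bracketψHom {i j : I} (h : i ≤ j) :
    (baseChange (X.ρ h)).obj (bracketObj N j) ⟶ bracketObj N i :=
  ModuleCat.ofHom (X := BaseChange (X.ρ h) (bracketObj N j)) (Y := bracketObj N i)
    (BaseChange.lift (bracketRes N h) (bracketRes_smul h))

variable {N}

lemma bracketψHom_tmul {i j : I} (h : i ≤ j) (x : bracketObj N j) (b : X.A i) :
    bracketψHom N h (BaseChange.tmul (X.ρ h) x b) = op b • bracketRes N h x :=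
  rfl

lemma bracketψHom_tmul_tmul {i j : I} (h : i ≤ j) (m : N) (a : X.A (j ⊓ s)) (b : X.A i) :
    bracketψHom N h (BaseChange.tmul (X.ρ h) (bracketTmul N j m a) b) =
      bracketTmul N i m (X.ρ (inf_le_inf_right s h) a * X.ρ inf_le_left b) := by
  rw [bracketψHom_tmul, bracketRes_tmul, bracketObj_smul]

section Bijective

variable {i j : I} (h : i ≤ j)

/-- `A_q` as a right `A_j`-module, for `q = j ∩ s`. -/
noncomputable def infMod (X : NCScheme.{w, u, t} k I) (s j : I) : ModuleCat.{u} (X.A j)ᵐᵒᵖ :=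
  (restr (X.ρ (inf_le_left : j ⊓ s ≤ j))).obj (ModuleCat.of (X.A (j ⊓ s))ᵐᵒᵖ (X.A (j ⊓ s)))

/-- Left multiplication `A_q → A_q`. -/
noncomputable def infModMul (j : I) (c : X.A (j ⊓ s)) : infMod X s j ⟶ infMod X s j :=
  (restr (X.ρ (inf_le_left : j ⊓ s ≤ j))).map (ModuleCat.ofHom
    { toFun := fun a => c * a
      map_add' := mul_add c
      map_smul' := fun b a => (mul_assoc c a b.unop).symm })

/-- The map `A_q → [N]_j`, `a ↦ m ⊗ a`. -/
noncomputable def orbit (j : I) (m : N) : infMod X s j ⟶ bracketObj N j :=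
  ModuleCat.ofHom (X := infMod X s j) (Y := bracketObj N j)
    { toFun := fun (a : X.A (j ⊓ s)) => bracketTmul N j m a
      map_add' := fun (a b : X.A (j ⊓ s)) => BaseChange.tmul_add m a b
      map_smul' := fun b (a : X.A (j ⊓ s)) => (bracketObj_smul j m a b.unop).symm }

/-- The map `A_q ⊗_{A_j} A_i → A_p`. -/
noncomputable def infMul (X : NCScheme.{w, u, t} k I) (s : I) {i j : I} (h : i ≤ j) :
    BaseChange (X.ρ h) (infMod X s j) →+ X.A (i ⊓ s) :=
  mulMap (X.ρ inf_le_left) (X.ρ h) (X.ρ (inf_le_inf_right s h)) (X.ρ inf_le_left)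
    (X.ρ_comp_ρ _ _ _ _)

lemma infMul_bijective [X.HasInter] : Function.Bijective (infMul X s h) :=
  NCScheme.HasInter.bijective (X := X) _ _ _ _
    (by rw [inf_right_comm, inf_eq_right.2 h])

lemma infMul_map (c : X.A (j ⊓ s)) (y : BaseChange (X.ρ h) (infMod X s j)) :
    infMul X s h ((baseChange (X.ρ h)).map (infModMul j c) y) =
      X.ρ (inf_le_inf_right s h) c * infMul X s h y := by
  induction y using BaseChange.induction_on with
  | h0 =>
    refine (congrArg (infMul X s h)
      (map_zero ((baseChange (X.ρ h)).map (infModMul j c)).hom)).trans ?_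
    refine (map_zero (infMul X s h)).trans ?_
    rw [map_zero, mul_zero]
  | h1 a b =>
    refine (congrArg (infMul X s h) (baseChange_map_tmul (X.ρ h) (infModMul j c) a b)).trans ?_
    refine Eq.trans ?_ (mul_assoc _ _ _)
    exact congrArg (· * X.ρ inf_le_left b) (map_mul (X.ρ (inf_le_inf_right s h)) c a)
  | h2 x y hx hy =>
    refine (congrArg (infMul X s h)
      (map_add ((baseChange (X.ρ h)).map (infModMul j c)).hom x y)).trans ?_
    refine (map_add (infMul X s h) _ _).trans ?_
    rw [map_add, mul_add]
    exact congrArg₂ (· + ·) hx hy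

lemma orbit_infMul (m : N) (y : BaseChange (X.ρ h) (infMod X s j)) :
    bracketψHom N h ((baseChange (X.ρ h)).map (orbit j m) y) =
      bracketTmul N i m (infMul X s h y) := by
  induction y using BaseChange.induction_on with
  | h0 =>
    refine (congrArg _ (map_zero ((baseChange (X.ρ h)).map (orbit j m)).hom)).trans ?_
    refine (map_zero (bracketψHom N h).hom).trans ?_
    rw [map_zero]
    exact (bracketTmul_zero i m).symm
  | h1 a b =>
    refine (congrArg _ (baseChange_map_tmul (X.ρ h) (orbit j m) a b)).trans ?_
    exact bracketψHom_tmul_tmul h m a b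
  | h2 x y hx hy =>
    refine (congrArg _ (map_add ((baseChange (X.ρ h)).map (orbit j m)).hom x y)).trans ?_
    refine (map_add (bracketψHom N h).hom _ _).trans ?_
    rw [map_add]
    exact (congrArg₂ (· + ·) hx hy).trans (bracketTmul_add i m _ _).symm

lemma bracketψHom_bijective [X.HasInter] : Function.Bijective (bracketψHom N h) := by
  have hb := infMul_bijective (s := s) (X := X) h
  let e : BaseChange (X.ρ h) (infMod X s j) ≃+ X.A (i ⊓ s) := AddEquiv.ofBijective _ hb
  have he : ∀ y, infMul X s h (e.symm y) = y := e.apply_symm_apply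
  have he' : ∀ y, e.symm (infMul X s h y) = y := e.symm_apply_apply
  constructor
  · let β : N →+ X.A (i ⊓ s) →+ ((baseChange (X.ρ h)).obj (bracketObj N j)) :=
      AddMonoidHom.mk' (fun m =>
        ((baseChange (X.ρ h)).map (orbit j m)).hom.toAddMonoidHom.comp e.symm.toAddMonoidHom)
        (fun m m' => by
          have : (orbit j (m + m') : infMod X s j ⟶ bracketObj N j) = orbit j m + orbit j m' :=
            ModuleCat.hom_ext (LinearMap.ext fun (a : X.A (j ⊓ s)) => BaseChange.add_tmul m m' a)
          rw [this, Functor.map_add]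
          rfl)
    have hβ : ∀ (m : N) (a : X.A s) (b : X.A (i ⊓ s)),
        β (op a • m) b = β m (X.ρ inf_le_right a * b) := by
      intro m a b
      have h1 : (orbit j (op a • m) : infMod X s j ⟶ bracketObj N j) =
          infModMul j (X.ρ inf_le_right a) ≫ orbit j m :=
        ModuleCat.hom_ext (LinearMap.ext fun (c : X.A (j ⊓ s)) => BaseChange.smul_tmul m a c)
      have h2 : e.symm (X.ρ inf_le_right a * b) =
          (baseChange (X.ρ h)).map (infModMul j (X.ρ inf_le_right a)) (e.symm b) := by
        refine hb.1 ?_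
        rw [he]
        refine Eq.trans ?_ (infMul_map h _ _).symm
        rw [he, X.ρ_ρ]
      change (baseChange (X.ρ h)).map (orbit j (op a • m)) (e.symm b) =
        (baseChange (X.ρ h)).map (orbit j m) (e.symm (X.ρ inf_le_right a * b))
      rw [h2, h1, Functor.map_comp]
      rfl
    let g : bracketObj N i →+ ((baseChange (X.ρ h)).obj (bracketObj N j)) :=
      BaseChange.liftAdd β hβ
    have hg : ∀ y, g (bracketψHom N h y) = y := by
      intro y
      induction y using BaseChange.induction_on with
      | h0 => exact (congrArg g (map_zero (bracketψHom N h).hom)).trans (map_zero g)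
      | h2 x y hx hy =>
        refine (congrArg g (map_add (bracketψHom N h).hom x y)).trans ((map_add g _ _).trans ?_)
        exact congrArg₂ (· + ·) hx hy
      | h1 x b =>
        induction x using bracketObj_induction with
        | h0 =>
          rw [BaseChange.zero_tmul]
          exact (congrArg g (map_zero (bracketψHom N h).hom)).trans (map_zero g)
        | h2 x y hx hy =>
          rw [BaseChange.add_tmul]
          refine (congrArg g (map_add (bracketψHom N h).hom _ _)).trans ((map_add g _ _).trans ?_)
          exact congrArg₂ (· + ·) hx hy
        | h1 m a =>
          refine (congrArg g (bracketψHom_tmul_tmul h m a b)).trans ?_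
          refine (BaseChange.liftAdd_tmul β hβ m _).trans ?_
          have h3 : e.symm (X.ρ (inf_le_inf_right s h) a * X.ρ inf_le_left b) =
              BaseChange.tmul (X.ρ h) (M := infMod X s j) a b := he' (BaseChange.tmul (X.ρ h) (M := infMod X s j) a b)
          refine (congrArg ((baseChange (X.ρ h)).map (orbit j m)) h3).trans ?_
          exact baseChange_map_tmul (X.ρ h) (orbit j m) a b
    exact Function.LeftInverse.injective hg
  · intro y
    induction y using bracketObj_induction with
    | h0 => exact ⟨0, map_zero (bracketψHom N h).hom⟩
    | h1 m c => exact ⟨_, (orbit_infMul h m (e.symm c)).trans (congrArg _ (he c))⟩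
    | h2 x y hx hy =>
      obtain ⟨x, rfl⟩ := hx
      obtain ⟨y, rfl⟩ := hy
      exact ⟨x + y, map_add (bracketψHom N h).hom x y⟩

end Bijective

variable (N)

/-- The quasi-coherent module `[N]` of a right `A_s`-module `N`. -/
noncomputable def bracket [X.HasInter] : Qcoh X where
  obj := bracketObj N
  ψ h := (LinearEquiv.ofBijective (bracketψHom N h).hom (bracketψHom_bijective h)).toModuleIso
  ψ_refl i m a := congrArg (op a • ·) (bracketRes_refl i m)
  ψ_comp hij hjl m a b := by
    change op b • bracketRes N hij (op a • bracketRes N hjl m) =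
      op (X.ρ hij a * b) • bracketRes N (hij.trans hjl) m
    rw [bracketRes_smul, bracketRes_comp, ← mul_smul, op_mul]

end Bracket

/-! ### The Čech complex -/

section Cech

variable (M : Qcoh X)

/-- The map `M_j → M_i`, `m ↦ ψ_ij(m ⊗ 1)`. -/
noncomputable def res {i j : I} (h : i ≤ j) : M.obj j →+ M.obj i where
  toFun m := (M.ψ h).hom (BaseChange.tmul (X.ρ h) m 1)
  map_zero' := by
    rw [BaseChange.zero_tmul]; exact map_zero (M.ψ h).hom.hom
  map_add' m m' := by
    rw [BaseChange.add_tmul]; exact map_add (M.ψ h).hom.hom _ _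

lemma ψ_tmul {i j : I} (h : i ≤ j) (m : M.obj j) (a : X.A i) :
    (M.ψ h).hom (BaseChange.tmul (X.ρ h) m a) = op a • M.res h m := by
  rw [BaseChange.tmul_eq]; exact map_smul (M.ψ h).hom.hom _ _

lemma res_smul {i j : I} (h : i ≤ j) (m : M.obj j) (a : X.A j) :
    M.res h (op a • m) = op (X.ρ h a) • M.res h m := by
  refine Eq.trans (congrArg (M.ψ h).hom ?_) (M.ψ_tmul h m (X.ρ h a))
  rw [BaseChange.smul_tmul, mul_one]

lemma res_res {i j l : I} (hij : i ≤ j) (hjl : j ≤ l) (m : M.obj l) :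
    M.res hij (M.res hjl m) = M.res (hij.trans hjl) m := by
  refine (M.ψ_comp hij hjl m 1 1).trans ?_
  rw [map_one, one_mul]
  rfl

/-- The componentwise additive map underlying `bracketMap`. -/
noncomputable def bracketMapAdd {s s' : I} (h : s' ≤ s) (i : I) :
    bracketObj (M.obj s) i →+ bracketObj (M.obj s') i :=
  BaseChange.push _ _ (M.res h) (X.ρ (inf_le_inf_left i h)) (fun m a => by
    rw [M.res_smul, BaseChange.smul_tmul, X.ρ_ρ, X.ρ_ρ, mul_one])

lemma bracketMapAdd_tmul {s s' : I} (h : s' ≤ s) (i : I) (m : M.obj s) (a : X.A (i ⊓ s)) :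
    M.bracketMapAdd h i (bracketTmul _ i m a) =
      bracketTmul _ i (M.res h m) (X.ρ (inf_le_inf_left i h) a) :=
  BaseChange.push_tmul _ _ _ _ _ m a

lemma bracketMapAdd_smul {s s' : I} (h : s' ≤ s) (i : I) (b : X.A i)
    (x : bracketObj (M.obj s) i) :
    M.bracketMapAdd h i (op b • x) = op b • M.bracketMapAdd h i x := by
  induction x using bracketObj_induction with
  | h0 => simp
  | h1 m c =>
    rw [bracketObj_smul, bracketMapAdd_tmul, bracketMapAdd_tmul, bracketObj_smul, map_mul, X.ρ_ρ]
  | h2 x y hx hy => rw [smul_add, map_add, map_add, smul_add, hx, hy]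

lemma bracketMapAdd_res {s s' : I} (h : s' ≤ s) {i j : I} (hij : i ≤ j)
    (x : bracketObj (M.obj s) j) :
    bracketRes (M.obj s') hij (M.bracketMapAdd h j x) =
      M.bracketMapAdd h i (bracketRes (M.obj s) hij x) := by
  induction x using bracketObj_induction with
  | h0 => simp
  | h1 m c =>
    rw [bracketMapAdd_tmul, bracketRes_tmul, bracketRes_tmul, bracketMapAdd_tmul, X.ρ_ρ, X.ρ_ρ]
  | h2 x y hx hy => rw [map_add, map_add, map_add, map_add, hx, hy]

variable {d : ℕ} (e : Fin d ≃ I)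

/-- The minimum `i(j_0) ∩ ⋯ ∩ i(j_p)` for `j_0 < ⋯ < j_p`, where `e` enumerates `I`. -/
def inter {p : ℕ} (J : Fin (p + 1) ↪o Fin d) : I :=
  Finset.univ.inf' Finset.univ_nonempty (fun l => e (J l))

/-- Omit the `a`-th index. -/
def face {p : ℕ} (J : Fin (p + 2) ↪o Fin d) (a : Fin (p + 2)) : Fin (p + 1) ↪o Fin d :=
  (Fin.succAboveOrderEmb a).trans J

lemma inter_le_face {p : ℕ} (J : Fin (p + 2) ↪o Fin d) (a : Fin (p + 2)) :
    inter e J ≤ inter e (face J a) :=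
  Finset.le_inf' _ _ fun l _ => Finset.inf'_le (fun l => e (J l)) (Finset.mem_univ (a.succAbove l))

variable [X.HasInter]

/-- For `s' ≤ s`, the natural homomorphism `[M_s] → [M_{s'}]`, given at `i` by
`m ⊗ a ↦ ψ(m ⊗ 1) ⊗ φ(a)`.  For `s' = j ∩ s` this is the natural map
`r_j : [M_s] → [[M_s]_j]` under the identification `[[M_s]_j] = [M_{j ∩ s}]`. -/
noncomputable def bracketMap {s s' : I} (h : s' ≤ s) : bracket (M.obj s) ⟶ bracket (M.obj s') where
  app i := ModuleCat.ofHom (X := bracketObj (M.obj s) i) (Y := bracketObj (M.obj s') i)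
    { toFun := M.bracketMapAdd h i
      map_add' := map_add _
      map_smul' := fun b x => M.bracketMapAdd_smul h i b.unop x }
  comm {i j} hij := by
    refine baseChange_hom_ext _ fun x b => ?_
    refine (congrArg (bracketψHom (M.obj s') hij) (baseChange_map_tmul (X.ρ hij) _ x b)).trans ?_
    change op b • bracketRes (M.obj s') hij (M.bracketMapAdd h j x) =
      M.bracketMapAdd h i (op b • bracketRes (M.obj s) hij x)
    exact (congrArg (op b • ·) (M.bracketMapAdd_res h hij x)).trans
      (M.bracketMapAdd_smul h i b _).symm

lemma bracketMap_comp {s s' s'' : I} (h : s' ≤ s) (h' : s'' ≤ s') :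
    M.bracketMap h ≫ M.bracketMap h' = M.bracketMap (h'.trans h) := by
  refine hom_ext fun i => ModuleCat.hom_ext (LinearMap.ext fun x => ?_)
  change M.bracketMapAdd h' i (M.bracketMapAdd h i x) = M.bracketMapAdd (h'.trans h) i x
  induction x using bracketObj_induction with
  | h0 => simp
  | h1 m c => rw [bracketMapAdd_tmul, bracketMapAdd_tmul, bracketMapAdd_tmul, M.res_res, X.ρ_ρ]
  | h2 x y hx hy => rw [map_add, map_add, map_add, hx, hy]

attribute [local instance] Abelian.hasFiniteBiproducts

/-- `Č^p(M) = ⨁_{j_0 < ⋯ < j_p} [M_{i(j_0) ∩ ⋯ ∩ i(j_p)}]`. -/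
noncomputable def cechX (p : ℕ) : Qcoh X :=
  ⨁ fun J : Fin (p + 1) ↪o Fin d => bracket (M.obj (inter e J))

/-- The projection `Č^p(M) → [M_{i(j_0) ∩ ⋯ ∩ i(j_p)}]`. -/
noncomputable def cechπ {p : ℕ} (J : Fin (p + 1) ↪o Fin d) :
    M.cechX e p ⟶ bracket (M.obj (inter e J)) :=
  biproduct.π _ J

/-- The Čech differential, the alternating sum of the natural maps
`[M_{⋂_{l ≠ a} i(j_l)}] → [M_{⋂ i(j_l)}]`. -/
noncomputable def cechD (p : ℕ) : M.cechX e p ⟶ M.cechX e (p + 1) :=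
  biproduct.lift fun J => ∑ a : Fin (p + 2),
    ((-1) ^ (a : ℕ) : ℤ) • (M.cechπ e (face J a) ≫ M.bracketMap (inter_le_face e J a))

lemma cechD_π (p : ℕ) (J : Fin (p + 2) ↪o Fin d) :
    M.cechD e p ≫ M.cechπ e J = ∑ a : Fin (p + 2),
      ((-1) ^ (a : ℕ) : ℤ) • (M.cechπ e (face J a) ≫ M.bracketMap (inter_le_face e J a)) :=
  biproduct.lift_π _ _

lemma face_face {p : ℕ} (J : Fin (p + 3) ↪o Fin d) (i : Fin (p + 2)) (j : Fin (p + 3))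
    (h : (j : ℕ) ≤ i) :
    face (face J j) i = face (face J i.succ) (j.castLT (lt_of_le_of_lt h i.is_lt)) := by
  refine RelEmbedding.ext fun l => congrArg J (Fin.ext ?_)
  change ((j.succAbove (i.succAbove l) : Fin (p + 3)) : ℕ) =
    (i.succ.succAbove ((j.castLT (lt_of_le_of_lt h i.is_lt)).succAbove l) : Fin (p + 3))
  simp only [Fin.succAbove, Fin.lt_def]
  split_ifs <;> simp_all <;> omega

lemma cech_term_congr {p : ℕ} {s : I} {J J' : Fin (p + 1) ↪o Fin d} (hJ : J = J')
    (h : s ≤ inter e J) (h' : s ≤ inter e J') :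
    M.cechπ e J ≫ M.bracketMap h = M.cechπ e J' ≫ M.bracketMap h' := by
  subst hJ; rfl

lemma cechD_comp (p : ℕ) : M.cechD e p ≫ M.cechD e (p + 1) = 0 := by
  refine biproduct.hom_ext _ _ fun J => ?_
  change (M.cechD e p ≫ M.cechD e (p + 1)) ≫ M.cechπ e J = 0 ≫ M.cechπ e J
  rw [Category.assoc, cechD_π, zero_comp, Preadditive.comp_sum]
  simp only [Preadditive.comp_zsmul, ← Category.assoc, cechD_π, Preadditive.sum_comp,
    Preadditive.zsmul_comp, Finset.smul_sum, smul_smul]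
  simp only [Category.assoc, bracketMap_comp]
  rw [← Finset.sum_product']
  let P := Fin (p + 3) × Fin (p + 2)
  let S : Finset P := {ij : P | (ij.1 : ℕ) ≤ (ij.2 : ℕ)}
  rw [Finset.univ_product_univ, ← Finset.sum_add_sum_compl S, ← eq_neg_iff_add_eq_zero,
    ← Finset.sum_neg_distrib]
  let φ : ∀ ij : P, ij ∈ S → P := fun ij hij =>
    (ij.2.succ, Fin.castLT ij.1 (lt_of_le_of_lt (Finset.mem_filter.mp hij).right (Fin.is_lt ij.2)))
  apply Finset.sum_bij φ
  · intro ij hij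
    simp_rw [S, φ, Finset.compl_filter, Finset.mem_filter_univ, Fin.val_succ,
      Fin.val_castLT] at hij ⊢
    omega
  · rintro ⟨j, i⟩ hij ⟨j', i'⟩ hij' h
    rw [Prod.mk_inj] at h ⊢
    exact ⟨Fin.ext (Fin.ext_iff.1 h.2 :), Fin.succ_injective _ h.1⟩
  · rintro ⟨i', j'⟩ hij'
    simp_rw [S, Finset.compl_filter, Finset.mem_filter_univ, not_le] at hij'
    refine ⟨(Fin.castSucc j', i'.pred ?_), ?_, ?_⟩
    · rintro rfl
      simp at hij'
    · simpa [S] using! Nat.le_sub_one_of_lt hij'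
    · simp only [φ, Fin.castLT_castSucc, Fin.succ_pred]
  · rintro ⟨j, i⟩ hij
    have hji : (j : ℕ) ≤ i := by simpa [S] using hij
    rw [← neg_smul]
    dsimp only [φ]
    refine congrArg₂ (· • ·) ?_ (M.cech_term_congr e (face_face J i j hji) _ _)
    simp only [Fin.val_succ, Fin.val_castLT, pow_succ]
    ring

/-- The Čech complex `Č^•(M)`; its terms vanish in degrees `p ≥ d = #I`. -/
noncomputable def cech : CochainComplex (Qcoh X) ℕ :=
  CochainComplex.of (M.cechX e) (M.cechD e) (M.cechD_comp e)

end Cech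

end Qcoh

/-- Convergence `E_1^{p,q} ⇒ H^{p+q}` of a first-quadrant cohomological spectral sequence: a finite
decreasing filtration `H^n = F^0 H^n ⊇ ⋯ ⊇ F^{n+1} H^n = 0` with
`E_∞^{p,q} ≅ F^p H^{p+q} / F^{p+1} H^{p+q}`.  Here `E_∞^{p,q}` is `E_r^{p,q}` for any
`r > max(p, q + 1)`, since from then on no differential enters or leaves the position `(p,q)`. -/
structure ConvergesTo {k : Type t} [Field k]
    (E : CohomologicalSpectralSequenceNat (ModuleCat.{v} k) 1)
    (H : ℕ → Type v) [∀ n, AddCommGroup (H n)] [∀ n, Module k (H n)] where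
  F : ∀ n : ℕ, ℕ → Submodule k (H n)
  antitone : ∀ n, Antitone (F n)
  F_zero : ∀ n, F n 0 = ⊤
  F_succ : ∀ n, F n (n + 1) = ⊥
  iso : ∀ (p q : ℕ) (r : ℤ) (hr : 1 ≤ r), (p : ℤ) < r → (q : ℤ) + 1 < r →
    ((E.page r hr).X (p, q) ≃ₗ[k]
      F (p + q) p ⧸ (F (p + q) (p + 1)).submoduleOf (F (p + q) p))

namespace Qcoh

variable {k : Type t} [Field k] {I : Type w} [SemilatticeInf I] {X : NCScheme.{w, u, t} k I}

/-- `M` is locally free of rank `r`: every `M_i` is a free right `A_i`-module of rank `r`. -/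
def IsLocallyFreeOfRank (M : Qcoh X) (r : ℕ) : Prop :=
  ∀ i, Nonempty (Module.Basis (Fin r) (X.A i)ᵐᵒᵖ (M.obj i))

/-- The complex of `k`-vector spaces `Hom_A(M, Č^•(N))`. -/
noncomputable def homCech [X.HasInter] {d : ℕ} (e : Fin d ≃ I) (M N : Qcoh X) :
    CochainComplex (ModuleCat k) ℕ :=
  (((linearCoyoneda k (Qcoh X)).obj (Opposite.op M)).mapHomologicalComplex _).obj (N.cech e)

end Qcoh
end NC

/-!
The Čech complex is a right resolution of `N`, and the theorem is the hypercohomology spectral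
sequence of this resolution.

*Exactness* (`Qcoh.cechResolution`) is checked at each `i = i(j)`.  The gluing isomorphisms identify
`[N_s]_i` with `N_{i ∩ s}`, so the natural map `[N_s]_i → [N_{s'}]_i` is bijective when
`i ∩ s = i ∩ s'`, in particular when `s'` arises from `s` by intersecting with `i`.  So a cochain
can be made to agree with a coboundary at all tuples containing `j`, by taking the component at `J`
from the insertion of `j` into `J`; and a cocycle vanishing at all tuples containing `j` is zero, by
the cocycle condition at the insertion of `j` into `J`.

*The spectral sequence.*  A resolution `0 → N → K⁰ → K¹ → ⋯` breaks up into short exact sequences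
`0 → Z^p → K^p → Z^{p+1} → 0` with `Z^0 = N`.  The long exact sequences of `Ext(M, -)` form an exact
couple with `D^{p,q} = Ext^q(M, Z^p)` and `E^{p,q} = Ext^q(M, K^p)`.  Its spectral sequence
(`ExactCouple.spectralSequence`) has the pages `Z_r / B_r` for explicit subspaces
`B_r ⊆ Z_r ⊆ E`, and it converges to `D^{0,n} = Ext^n(M, N)`, filtered by the images of the
`D^{p,n-p}` (`ExactCouple.convergesTo`).

*The locally free case.*  The functor `N ↦ [N]` is exact and right adjoint to the exact functor
`M ↦ M_s` (`Qcoh.bracketAdj`), so `Ext^q(M, [N])` vanishes for `q > 0` as soon as `M_s` is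
projective (`ext_rightAdjoint_eq_zero`).  Then the exact couple has `E^{p,q} = 0` for `q > 0`, and
the homology of `E^{•,0} = Hom(M, Č^•(N))` is `Ext(M, N)` (`ExactCouple.nonempty_homology_equiv`).
-/

namespace NC

open CategoryTheory CategoryTheory.Limits MulOpposite TensorProduct

/-! ### Exact couples in the first quadrant -/

/-- A first-quadrant exact couple of `k`-vector spaces
`⋯ → D^{p+1,q} → D^{p,q+1} → E^{p,q+1} → D^{p+1,q+1} → ⋯`, beginning with
`0 → D^{p,0} → E^{p,0}`. -/
structure ExactCouple (k : Type t) [Field k] where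
  D : ℕ → ℕ → Type v
  E : ℕ → ℕ → Type v
  [addCommGroupD : ∀ p q, AddCommGroup (D p q)]
  [moduleD : ∀ p q, Module k (D p q)]
  [addCommGroupE : ∀ p q, AddCommGroup (E p q)]
  [moduleE : ∀ p q, Module k (E p q)]
  i : ∀ p q, D (p + 1) q →ₗ[k] D p (q + 1)
  j : ∀ p q, D p q →ₗ[k] E p q
  del : ∀ p q, E p q →ₗ[k] D (p + 1) q
  exact_i_j : ∀ p q, Function.Exact (i p q) (j p (q + 1))
  j_injective : ∀ p, Function.Injective (j p 0)
  exact_j_del : ∀ p q, Function.Exact (j p q) (del p q)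
  exact_del_i : ∀ p q, Function.Exact (del p q) (i p q)

attribute [instance] ExactCouple.addCommGroupD ExactCouple.moduleD ExactCouple.addCommGroupE
  ExactCouple.moduleE

/-- A linear map `T` between vector spaces has a generalized inverse `S`, with `T S T = T`. -/
lemma exists_generalizedInverse {k V W : Type*} [Field k] [AddCommGroup V] [Module k V]
    [AddCommGroup W] [Module k W] (T : V →ₗ[k] W) :
    ∃ S : W →ₗ[k] V, ∀ v, T (S (T v)) = T v := by
  obtain ⟨g, hg⟩ := T.rangeRestrict.exists_rightInverse_of_surjective T.range_rangeRestrict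
  obtain ⟨S, hS⟩ := g.exists_extend
  refine ⟨S, fun v => ?_⟩
  have h1 : S (T v) = g (T.rangeRestrict v) := LinearMap.congr_fun hS (T.rangeRestrict v)
  rw [h1]
  exact congrArg Subtype.val (LinearMap.congr_fun hg (T.rangeRestrict v))

/-- If `π` maps `V` onto the cycles of a complex of vector spaces, then the homology is the
quotient of `V` by the preimage of the boundaries. -/
noncomputable def homologyEquivOfSurjective {k : Type t} [Field k]
    (S : ShortComplex (ModuleCat.{v} k)) {V : Type*} [AddCommGroup V] [Module k V]
    (N : Submodule k V) (π : V →ₗ[k] S.X₂) (hπ : LinearMap.range π = LinearMap.ker S.g.hom)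
    (hN : (LinearMap.range S.f.hom).comap π = N) : S.homology ≃ₗ[k] V ⧸ N :=
  let π' : V →ₗ[k] LinearMap.ker S.g.hom :=
    π.codRestrict _ fun x => by rw [← hπ]; exact ⟨x, rfl⟩
  let σ : V →ₗ[k] (LinearMap.ker S.g.hom ⧸ LinearMap.range S.moduleCatToCycles) :=
    (LinearMap.range S.moduleCatToCycles).mkQ.comp π'
  have hσ : Function.Surjective σ := (Submodule.mkQ_surjective _).comp fun ⟨y, hy⟩ => by
    rw [← hπ] at hy
    obtain ⟨x, rfl⟩ := hy
    exact ⟨x, rfl⟩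
  have hker : LinearMap.ker σ = N := by
    rw [← hN]
    ext x
    change (LinearMap.range S.moduleCatToCycles).mkQ (π' x) = 0 ↔ π x ∈ LinearMap.range S.f.hom
    rw [← LinearMap.mem_ker, Submodule.ker_mkQ]
    exact ⟨fun ⟨y, hy⟩ => ⟨y, congrArg Subtype.val hy⟩, fun ⟨y, hy⟩ => ⟨y, Subtype.ext hy⟩⟩
  S.moduleCatHomologyIso.toLinearEquiv ≪≫ₗ
    ((Submodule.quotEquivOfEq _ _ hker.symm) ≪≫ₗ σ.quotKerEquivOfSurjective hσ).symm

namespace ExactCouple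

variable {k : Type t} [Field k] (C : ExactCouple.{v, t} k)

lemma i_del {p q : ℕ} (x : C.E p q) : C.i p q (C.del p q x) = 0 :=
  (C.exact_del_i p q).apply_apply_eq_zero x

lemma del_j {p q : ℕ} (x : C.D p q) : C.del p q (C.j p q x) = 0 :=
  (C.exact_j_del p q).apply_apply_eq_zero x

lemma j_i {p q : ℕ} (x : C.D (p + 1) q) : C.j p (q + 1) (C.i p q x) = 0 :=
  (C.exact_i_j p q).apply_apply_eq_zero x

/-- The `m`-fold composite `D^{p+m,q} → D^{p,q+m}` of the maps `i`.  The indices are tied by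
equations, so that composing needs no transport along equalities of indices. -/
def iter : ∀ (m : ℕ) {p q p' q' : ℕ}, p + m = p' → q' + m = q → (C.D p' q' →ₗ[k] C.D p q)
  | 0, p, q, p', q', hp, hq => by
    obtain rfl : p = p' := hp
    obtain rfl : q' = q := hq
    exact LinearMap.id
  | _ + 1, _, 0, _, _, _, hq => absurd hq (Nat.succ_ne_zero _)
  | m + 1, p, q + 1, p', q', hp, hq =>
    (C.i p q).comp (iter m (p := p + 1) (q := q) (by omega) (by omega))

lemma iter_zero {p q : ℕ} (x : C.D p q) : C.iter 0 rfl rfl x = x := rfl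

lemma iter_succ {m p q p' q' : ℕ} (hp : p + (m + 1) = p') (hq : q' + (m + 1) = q + 1)
    (x : C.D p' q') :
    C.iter (m + 1) hp hq x =
      C.i p q (C.iter m (p := p + 1) (q := q) (by omega) (by omega) x) := rfl

lemma iter_succ' {m : ℕ} : ∀ {p q p' q' : ℕ} (hp : p + (m + 1) = p' + 1)
    (hq : q' + (m + 1) = q) (x : C.D (p' + 1) q'),
    C.iter (m + 1) hp hq x =
      C.iter m (p := p) (q := q) (p' := p') (q' := q' + 1) (by omega) (by omega)
        (C.i p' q' x) := by
  induction m with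
  | zero =>
    intro p q p' q' hp hq x
    obtain rfl : p = p' := by omega
    obtain rfl : q' + 1 = q := hq
    rfl
  | succ m ih =>
    intro p q p' q' hp hq x
    obtain _ | q := q
    · omega
    · rw [iter_succ, iter_succ, ih]

/-- The image of the `m`-fold composite of the maps `i` in `D^{p,q}`, which is zero when `m > q`. -/
def im : ℕ → ∀ p q : ℕ, Submodule k (C.D p q)
  | 0, _, _ => ⊤
  | _ + 1, _, 0 => ⊥
  | m + 1, p, q + 1 => (im m (p + 1) q).map (C.i p q)

/-- The kernel of the `m`-fold composite of the maps `i` on `D^{p,q}`.  The composite stops at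
`D^{0,p+q}` when `m > p`. -/
def kr : ℕ → ∀ p q : ℕ, Submodule k (C.D p q)
  | 0, _, _ => ⊥
  | _ + 1, 0, _ => ⊥
  | m + 1, p + 1, q => (kr m p (q + 1)).comap (C.i p q)

lemma im_eq_bot : ∀ {m p q : ℕ}, q < m → C.im m p q = ⊥
  | _ + 1, _, 0, _ => rfl
  | m + 1, p, q + 1, h => by
    rw [im, im_eq_bot (m := m) (by omega), Submodule.map_bot]

lemma im_eq_range : ∀ {m p q p' q' : ℕ} (hp : p + m = p') (hq : q' + m = q),
    C.im m p q = LinearMap.range (C.iter m hp hq)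
  | 0, p, q, p', q', hp, hq => by
    obtain rfl : p = p' := hp
    obtain rfl : q' = q := hq
    exact LinearMap.range_id.symm
  | _ + 1, _, 0, _, _, _, hq => absurd hq (Nat.succ_ne_zero _)
  | m + 1, p, q + 1, p', q', hp, hq => by
    rw [im, im_eq_range (m := m) (p' := p') (q' := q') (by omega) (by omega), iter,
      LinearMap.range_comp]

lemma im_succ_le : ∀ m p q : ℕ, C.im (m + 1) p q ≤ C.im m p q
  | 0, _, _ => le_top
  | _ + 1, _, 0 => le_rfl
  | m + 1, p, q + 1 => Submodule.map_mono (im_succ_le m (p + 1) q)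

lemma im_antitone (p q : ℕ) : Antitone fun m => C.im m p q :=
  antitone_nat_of_succ_le fun m => C.im_succ_le m p q

lemma kr_eq_ker : ∀ {m p q p' q' : ℕ} (hp : p + m = p') (hq : q' + m = q),
    C.kr m p' q' = LinearMap.ker (C.iter m hp hq)
  | 0, p, q, p', q', hp, hq => by
    obtain rfl : p = p' := hp
    obtain rfl : q' = q := hq
    exact LinearMap.ker_id.symm
  | _ + 1, _, _, 0, _, hp, _ => absurd hp (Nat.succ_ne_zero _)
  | m + 1, p, q, p' + 1, q', hp, hq => by
    rw [kr, kr_eq_ker (m := m) (p := p) (q := q) (by omega) (by omega)]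
    ext x
    simp only [Submodule.mem_comap, LinearMap.mem_ker, iter_succ']

lemma kr_succ_eq : ∀ {m p : ℕ} (q : ℕ), p ≤ m → C.kr (m + 1) p q = C.kr m p q
  | 0, 0, _, _ => rfl
  | _ + 1, 0, _, _ => rfl
  | m + 1, p + 1, q, h => by
    rw [kr, kr_succ_eq (m := m) (q + 1) (by omega), kr]

lemma kr_eq_of_le {m p : ℕ} (q : ℕ) (h : p ≤ m) : C.kr m p q = C.kr p p q := by
  induction m, h using Nat.le_induction with
  | base => rfl
  | succ m h ih => rw [C.kr_succ_eq q h, ih]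

lemma kr_le_succ : ∀ m p q : ℕ, C.kr m p q ≤ C.kr (m + 1) p q
  | 0, _, _ => bot_le
  | _ + 1, 0, _ => le_rfl
  | m + 1, p + 1, q => Submodule.comap_mono (kr_le_succ m p (q + 1))

/-- The cycles `Z_r^{p,q} ⊆ E^{p,q}` for `r = m + 1`. -/
def Z (m p q : ℕ) : Submodule k (C.E p q) := (C.im m (p + 1) q).comap (C.del p q)

/-- The boundaries `B_r^{p,q} ⊆ E^{p,q}` for `r = m + 1`. -/
def B (m p q : ℕ) : Submodule k (C.E p q) := (C.kr m p q).map (C.j p q)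

lemma j_mem_Z (m : ℕ) {p q : ℕ} (x : C.D p q) : C.j p q x ∈ C.Z m p q := by
  change C.del p q (C.j p q x) ∈ C.im m (p + 1) q
  rw [C.del_j]
  exact zero_mem _

lemma del_of_mem_B {m p q : ℕ} {x : C.E p q} (hx : x ∈ C.B m p q) : C.del p q x = 0 := by
  obtain ⟨y, -, rfl⟩ := hx
  exact C.del_j y

lemma Z_succ_le (m p q : ℕ) : C.Z (m + 1) p q ≤ C.Z m p q :=
  Submodule.comap_mono (C.im_succ_le m (p + 1) q)

lemma B_le_succ (m p q : ℕ) : C.B m p q ≤ C.B (m + 1) p q :=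
  Submodule.map_mono (C.kr_le_succ m p q)

lemma B_le_Z (m n p q : ℕ) : C.B m p q ≤ C.Z n p q := by
  rintro _ ⟨y, -, rfl⟩
  exact C.j_mem_Z n y

/-- The term `E_r^{p,q} = Z_r^{p,q} / B_r^{p,q}` for `r = m + 1`. -/
abbrev Page (m p q : ℕ) : Type v := C.Z m p q ⧸ (C.B m p q).submoduleOf (C.Z m p q)

lemma page_mk_eq_iff {m p q : ℕ} {x y : C.Z m p q} :
    (Submodule.Quotient.mk x : C.Page m p q) = Submodule.Quotient.mk y ↔
      (x : C.E p q) - y ∈ C.B m p q :=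
  Submodule.Quotient.eq ((C.B m p q).submoduleOf (C.Z m p q))

section Differential

variable {m p q p' q' : ℕ} (hp : p + (m + 1) = p') (hq : q' + m = q)

/-- A lift of the differential of `E_{m+1}` to `E^{p,q}`: apply `del`, then a generalized inverse
of the `m`-fold composite of the maps `i`, then `j`. -/
noncomputable def dE : C.E p q →ₗ[k] C.E p' q' :=
  (C.j p' q').comp ((exists_generalizedInverse
    (C.iter m (p := p + 1) (q := q) (p' := p') (q' := q') (by omega) hq)).choose.comp (C.del p q))

/-- The differential may be computed from any preimage `w` of `del x`. -/
lemma dE_sub_mem {x : C.E p q} {w : C.D p' q'}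
    (hw : C.iter m (p := p + 1) (q := q) (by omega) hq w = C.del p q x) :
    C.dE hp hq x - C.j p' q' w ∈ C.B m p' q' := by
  have hS := (exists_generalizedInverse
    (C.iter m (p := p + 1) (q := q) (p' := p') (q' := q') (by omega) hq)).choose_spec w
  refine ⟨_, ?_, map_sub (C.j p' q') _ w⟩
  rw [C.kr_eq_ker (p := p + 1) (q := q) (by omega) hq]
  simp only [SetLike.mem_coe, LinearMap.mem_ker, map_sub, sub_eq_zero]
  rw [← hS, hw]
  rfl

lemma dE_of_del_eq_zero {x : C.E p q} (hx : C.del p q x = 0) : C.dE hp hq x = 0 := by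
  simp [dE, hx]

lemma dE_mem_Z (n : ℕ) (x : C.E p q) : C.dE hp hq x ∈ C.Z n p' q' := C.j_mem_Z n _

lemma del_dE (x : C.E p q) : C.del p' q' (C.dE hp hq x) = 0 := C.del_j _

/-- The differential of the page `E_{m+1}`. -/
noncomputable def dPage : C.Page m p q →ₗ[k] C.Page m p' q' :=
  Submodule.mapQ _ _ ((C.dE hp hq).restrict fun x _ => C.dE_mem_Z hp hq m x) fun x hx =>
    Submodule.mem_comap.2 <| by
      change C.dE hp hq (x : C.E p q) ∈ C.B m p' q'
      have hx' : (x : C.E p q) ∈ C.B m p q := hx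
      rw [C.dE_of_del_eq_zero hp hq (C.del_of_mem_B hx')]
      exact zero_mem _

lemma dPage_mk (x : C.Z m p q) :
    C.dPage hp hq (Submodule.Quotient.mk x) =
      Submodule.Quotient.mk ⟨C.dE hp hq x, C.dE_mem_Z hp hq m x⟩ := rfl

lemma dPage_dPage {p'' q'' : ℕ} (hp' : p' + (m + 1) = p'') (hq' : q'' + m = q')
    (x : C.Page m p q) : C.dPage hp' hq' (C.dPage hp hq x) = 0 := by
  obtain ⟨x, rfl⟩ := Submodule.Quotient.mk_surjective _ x
  rw [dPage_mk, dPage_mk, Submodule.Quotient.mk_eq_zero]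
  change C.dE hp' hq' (C.dE hp hq x) ∈ C.B m p'' q''
  rw [C.dE_of_del_eq_zero hp' hq' (C.del_dE hp hq _)]
  exact zero_mem _

/-- The cycles for the differential of `E_{m+1}` are the classes of `Z_{m+2}`. -/
lemma dE_mem_B_iff {x : C.E p q} (hx : x ∈ C.Z m p q) :
    C.dE hp hq x ∈ C.B m p' q' ↔ x ∈ C.Z (m + 1) p q := by
  have hx' : C.del p q x ∈ C.im m (p + 1) q := hx
  rw [C.im_eq_range (p' := p') (q' := q') (by omega) hq] at hx'
  obtain ⟨w, hw⟩ := hx'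
  have h1 := C.dE_sub_mem hp hq hw
  constructor
  · intro h2
    have h3 : C.j p' q' w ∈ C.B m p' q' := by
      simpa using (C.B m p' q').sub_mem h2 h1
    obtain ⟨z, hz, hzw⟩ := h3
    rw [C.kr_eq_ker (p := p + 1) (q := q) (by omega) hq] at hz
    have hz' : C.iter m (p := p + 1) (q := q) (by omega) hq z = 0 := hz
    have h4 : C.j p' q' (w - z) = 0 := by rw [map_sub, hzw, sub_self]
    change C.del p q x ∈ C.im (m + 1) (p + 1) q
    have h5 : C.iter m (p := p + 1) (q := q) (by omega) hq (w - z) = C.del p q x := by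
      rw [map_sub, hz', sub_zero, hw]
    obtain _ | q' := q'
    · have : w - z = 0 := C.j_injective p' (h4.trans (map_zero _).symm)
      rw [← h5, this, map_zero]
      exact zero_mem _
    · obtain ⟨y, hy⟩ := (C.exact_i_j p' q' _).1 h4
      rw [C.im_eq_range (p' := p' + 1) (q' := q') (by omega) (by omega)]
      exact ⟨y, by rw [iter_succ', hy, h5]⟩
  · intro h2
    have h3 : C.del p q x ∈ C.im (m + 1) (p + 1) q := h2
    by_cases hq0 : q < m + 1
    · rw [C.im_eq_bot hq0] at h3
      rw [C.dE_of_del_eq_zero hp hq h3]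
      exact zero_mem _
    · obtain _ | q' := q'
      · omega
      · rw [C.im_eq_range (p' := p' + 1) (q' := q') (by omega) (by omega)] at h3
        obtain ⟨y, hy⟩ := h3
        rw [iter_succ'] at hy
        have := C.dE_sub_mem hp hq hy
        rwa [C.j_i, sub_zero] at this

/-- The boundaries for the differential of `E_{m+1}` are the classes of `B_{m+2}`. -/
lemma mem_B_succ_iff {y : C.E p' q'} :
    y ∈ C.B (m + 1) p' q' ↔ ∃ x ∈ C.Z m p q, C.dE hp hq x - y ∈ C.B m p' q' := by
  constructor
  · rintro ⟨w, hw, rfl⟩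
    rw [C.kr_eq_ker (p := p) (q := q + 1) hp (by omega)] at hw
    have hw' : C.i p q (C.iter m (p := p + 1) (q := q) (by omega) hq w) = 0 := hw
    obtain ⟨x, hx⟩ := (C.exact_del_i p q _).1 hw'
    refine ⟨x, ?_, C.dE_sub_mem hp hq hx.symm⟩
    change C.del p q x ∈ C.im m (p + 1) q
    rw [C.im_eq_range (p' := p') (q' := q') (by omega) hq, hx]
    exact ⟨w, rfl⟩
  · rintro ⟨x, hx, hxy⟩
    have hx' : C.del p q x ∈ C.im m (p + 1) q := hx
    rw [C.im_eq_range (p' := p') (q' := q') (by omega) hq] at hx'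
    obtain ⟨w, hw⟩ := hx'
    have h1 := C.dE_sub_mem hp hq hw
    have h2 : C.j p' q' w ∈ C.B (m + 1) p' q' := by
      refine ⟨w, ?_, rfl⟩
      rw [C.kr_eq_ker (p := p) (q := q + 1) hp (by omega)]
      change C.i p q _ = 0
      rw [hw, C.i_del]
    have h3 : C.j p' q' w - y ∈ C.B m p' q' := by
      simpa using (C.B m p' q').sub_mem hxy h1
    simpa using (C.B (m + 1) p' q').sub_mem h2 (C.B_le_succ _ _ _ h3)

end Differential

/-- The page `E_r` for `r = m + 1`. -/
noncomputable def page (r : ℤ) (m : ℕ) (hr : r = m + 1) :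
    HomologicalComplex (ModuleCat.{v} k) (ComplexShape.spectralSequenceNat ⟨r, 1 - r⟩) where
  X pq := ModuleCat.of k (C.Page m pq.1 pq.2)
  d a b := open Classical in
    if h : (ComplexShape.spectralSequenceNat ⟨r, 1 - r⟩).Rel a b then
      ModuleCat.ofHom (C.dPage (by have := h.1; dsimp at this; omega)
        (by have := h.2; dsimp at this; omega))
    else 0
  shape a b h := dif_neg h
  d_comp_d' a b c hab hbc := by
    rw [dif_pos hab, dif_pos hbc]
    exact ModuleCat.hom_ext (LinearMap.ext fun x => C.dPage_dPage _ _ _ _ x)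

lemma page_d (r : ℤ) (m : ℕ) (hr : r = m + 1) {p q p' q' : ℕ} (hp : p + (m + 1) = p')
    (hq : q' + m = q) :
    (C.page r m hr).d (p, q) (p', q') = ModuleCat.ofHom (C.dPage hp hq) :=
  dif_pos ⟨by dsimp; omega, by dsimp; omega⟩

/-- The inclusion `Z_{m+2} ⊆ Z_{m+1}` followed by the projection to `E_{m+1}`. -/
def cyclesToPage (m p q : ℕ) : C.Z (m + 1) p q →ₗ[k] C.Page m p q :=
  (Submodule.mkQ _).comp (Submodule.inclusion (C.Z_succ_le m p q))

lemma range_cyclesToPage (m p q : ℕ) (x : C.Z m p q) :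
    (Submodule.Quotient.mk x : C.Page m p q) ∈ LinearMap.range (C.cyclesToPage m p q) ↔
      (x : C.E p q) ∈ C.Z (m + 1) p q := by
  constructor
  · rintro ⟨y, hy⟩
    have : (y : C.E p q) - x ∈ C.B m p q := C.page_mk_eq_iff.1 hy
    simpa using (C.Z (m + 1) p q).sub_mem y.2 (C.B_le_Z m (m + 1) p q this)
  · intro h
    exact ⟨⟨x, h⟩, rfl⟩

lemma range_cyclesToPage_eq_ker (r : ℤ) (m : ℕ) (hr : r = m + 1) (a : ℕ × ℕ) :
    LinearMap.range (C.cyclesToPage m a.1 a.2) =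
      LinearMap.ker ((C.page r m hr).sc a).g.hom := by
  obtain ⟨p, q⟩ := a
  ext x
  obtain ⟨x, rfl⟩ := Submodule.Quotient.mk_surjective _ x
  rw [C.range_cyclesToPage]
  by_cases h : m ≤ q
  · have hn : (ComplexShape.spectralSequenceNat ⟨r, 1 - r⟩).next (p, q) = (p + (m + 1), q - m) :=
      ComplexShape.next_eq' _ ⟨by dsimp; omega, by dsimp; omega⟩
    change _ ↔ (C.page r m hr).d (p, q)
      ((ComplexShape.spectralSequenceNat ⟨r, 1 - r⟩).next (p, q)) _ = 0
    rw [hn, C.page_d r m hr rfl (show q - m + m = q by omega)]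
    change _ ↔ (C.dPage rfl _ (Submodule.Quotient.mk x) : C.Page m (p + (m + 1)) (q - m)) = 0
    rw [dPage_mk, Submodule.Quotient.mk_eq_zero]
    exact (C.dE_mem_B_iff rfl (show q - m + m = q by omega) x.2).symm
  -- The target of the differential has negative second index, and `Z_{m+1} = Z_{m+2} = ker del`.
  · have hd : ((C.page r m hr).sc (p, q)).g = 0 := by
      refine (C.page r m hr).shape _ _ fun hrel => ?_
      have := hrel.2
      dsimp at this
      omega
    rw [hd]
    have hx : C.del p q x ∈ C.im m (p + 1) q := x.2
    rw [C.im_eq_bot (by omega)] at hx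
    refine ⟨fun _ => rfl, fun _ => ?_⟩
    change C.del p q x ∈ C.im (m + 1) (p + 1) q
    rwa [C.im_eq_bot (by omega)]

lemma comap_cyclesToPage_range (r : ℤ) (m : ℕ) (hr : r = m + 1) (a : ℕ × ℕ) :
    (LinearMap.range ((C.page r m hr).sc a).f.hom).comap (C.cyclesToPage m a.1 a.2) =
      (C.B (m + 1) a.1 a.2).submoduleOf (C.Z (m + 1) a.1 a.2) := by
  obtain ⟨p, q⟩ := a
  ext x
  change _ ↔ (x : C.E p q) ∈ C.B (m + 1) p q
  by_cases h : m + 1 ≤ p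
  · obtain ⟨p, rfl⟩ := Nat.exists_eq_add_of_le' h
    have hn : (ComplexShape.spectralSequenceNat ⟨r, 1 - r⟩).prev (p + (m + 1), q) = (p, q + m) :=
      ComplexShape.prev_eq' _ ⟨by dsimp; omega, by dsimp; omega⟩
    rw [C.mem_B_succ_iff (p := p) (q := q + m) rfl rfl]
    change (∃ y, (C.page r m hr).d
      ((ComplexShape.spectralSequenceNat ⟨r, 1 - r⟩).prev (p + (m + 1), q)) (p + (m + 1), q) y =
      _) ↔ _
    rw [hn, C.page_d r m hr rfl rfl]
    constructor
    · rintro ⟨y, hy⟩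
      obtain ⟨y, rfl⟩ := Submodule.Quotient.mk_surjective _ y
      exact ⟨y, y.2, C.page_mk_eq_iff.1 hy⟩
    · rintro ⟨y, hy, hyx⟩
      exact ⟨Submodule.Quotient.mk ⟨y, hy⟩, C.page_mk_eq_iff.2 hyx⟩
  -- The source of the differential has negative first index, and `B_{m+1} = B_{m+2}`.
  · have hd : ((C.page r m hr).sc (p, q)).f = 0 := by
      refine (C.page r m hr).shape _ _ fun hrel => ?_
      have := hrel.1
      dsimp at this
      omega
    have hB : C.B (m + 1) p q = C.B m p q := by
      rw [B, C.kr_succ_eq q (by omega), B]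
    rw [hd, hB]
    have h0 : C.cyclesToPage m p q x = 0 ↔ (x : C.E p q) ∈ C.B m p q :=
      Submodule.Quotient.mk_eq_zero ((C.B m p q).submoduleOf (C.Z m p q))
    rw [← h0]
    exact ⟨fun ⟨y, hy⟩ => hy.symm, fun hy => ⟨0, hy.symm⟩⟩

/-- The homology of `E_r` is `E_{r+1}`. -/
noncomputable def pageIso (r r' : ℤ) (m m' : ℕ) (hr : r = m + 1) (hr' : r' = m' + 1)
    (h : m' = m + 1) (a : ℕ × ℕ) :
    (C.page r m hr).homology a ≅ (C.page r' m' hr').X a := by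
  subst h
  exact (homologyEquivOfSurjective ((C.page r m hr).sc a) _ (C.cyclesToPage m a.1 a.2)
    (C.range_cyclesToPage_eq_ker r m hr a) (C.comap_cyclesToPage_range r m hr a)).toModuleIso

/-- The spectral sequence of an exact couple.  The pages are indexed by integers `r ≥ 1`, so that
`r - 1` is the exponent `m` of the iterates of `i` entering `E_r`. -/
noncomputable def spectralSequence : CohomologicalSpectralSequenceNat (ModuleCat.{v} k) 1 where
  page r hr := C.page r (r - 1).toNat (by omega)
  iso r r' a hrr' hr := C.pageIso r r' _ _ (by omega) (by omega) (by omega) a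

lemma Z_zero (p q : ℕ) : C.Z 0 p q = ⊤ := rfl

lemma B_zero (p q : ℕ) : C.B 0 p q = ⊥ := Submodule.map_bot _

/-- `Z_1 / B_1` is all of `E`. -/
noncomputable def pageZeroEquiv (p q : ℕ) : C.Page 0 p q ≃ₗ[k] C.E p q :=
  (Submodule.quotEquivOfEqBot _ (by
    rw [B_zero, Submodule.submoduleOf, Submodule.comap_bot, Submodule.ker_subtype])) ≪≫ₗ
    LinearEquiv.ofTop _ (C.Z_zero p q)

lemma pageZeroEquiv_dPage {p q : ℕ} (x : C.Page 0 p q) :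
    C.pageZeroEquiv (p + 1) q (C.dPage (m := 0) rfl rfl x) =
      C.j (p + 1) q (C.del p q (C.pageZeroEquiv p q x)) := by
  obtain ⟨x, rfl⟩ := Submodule.Quotient.mk_surjective _ x
  have h := C.dE_sub_mem (m := 0) (p := p) (q := q) (x := x) rfl rfl (C.iter_zero _)
  rw [B_zero, Submodule.mem_bot, sub_eq_zero] at h
  exact h

/-- The first page of the spectral sequence is `E`. -/
noncomputable def firstPageEquiv (h : (1 : ℤ) ≤ 1) (p q : ℕ) :
    (C.spectralSequence.page 1 h).X (p, q) ≃ₗ[k] C.E p q := C.pageZeroEquiv p q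

/-- The differential of the first page is `j ∘ del`. -/
lemma firstPageEquiv_d (h : (1 : ℤ) ≤ 1) {p q : ℕ}
    (x : (C.spectralSequence.page 1 h).X (p, q)) :
    C.firstPageEquiv h (p + 1) q ((C.spectralSequence.page 1 h).d (p, q) (p + 1, q) x) =
      C.j (p + 1) q (C.del p q (C.firstPageEquiv h p q x)) := by
  have h' : (C.spectralSequence.page 1 h).d (p, q) (p + 1, q) =
      ModuleCat.ofHom (C.dPage (m := 0) rfl rfl) := C.page_d 1 0 (by omega) rfl rfl
  rw [h']
  exact C.pageZeroEquiv_dPage x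

/-- `E_∞^{p,q} ≅ i^p(D^{p,q}) / i^{p+1}(D^{p+1,q-1})` inside `D^{0,p+q}`: both sides are quotients
of `D^{p,q}` by `ker i^p + ker j = ker i^p + range i`, since here `Z_{m+1} = ker del = range j` and
`B_{m+1} = j(ker i^p)`. -/
lemma nonempty_page_equiv {m p q : ℕ} (hp : p ≤ m) (hq : q < m) :
    Nonempty (C.Page m p q ≃ₗ[k]
      C.im p 0 (p + q) ⧸ (C.im (p + 1) 0 (p + q)).submoduleOf (C.im p 0 (p + q))) := by
  let σ : C.D p q →ₗ[k] C.Page m p q :=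
    (Submodule.mkQ _).comp ((C.j p q).codRestrict (C.Z m p q) fun x => C.j_mem_Z m x)
  let T : C.D p q →ₗ[k] C.D 0 (p + q) := C.iter p (zero_add p) (add_comm q p)
  have hT : C.im p 0 (p + q) = LinearMap.range T := C.im_eq_range _ _
  let τ : C.D p q →ₗ[k]
      (C.im p 0 (p + q) ⧸ (C.im (p + 1) 0 (p + q)).submoduleOf (C.im p 0 (p + q))) :=
    (Submodule.mkQ _).comp (T.codRestrict _ fun x => by rw [hT]; exact ⟨x, rfl⟩)
  have hσ : Function.Surjective σ := by
    intro y
    obtain ⟨y, rfl⟩ := Submodule.Quotient.mk_surjective _ y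
    have hy : C.del p q y ∈ C.im m (p + 1) q := y.2
    rw [C.im_eq_bot hq] at hy
    obtain ⟨x, hx⟩ := (C.exact_j_del p q _).1 hy
    exact ⟨x, congrArg Submodule.Quotient.mk (Subtype.ext hx)⟩
  have hτ : Function.Surjective τ := by
    intro y
    obtain ⟨⟨y, hy⟩, rfl⟩ := Submodule.Quotient.mk_surjective _ y
    rw [hT] at hy
    obtain ⟨x, rfl⟩ := hy
    exact ⟨x, rfl⟩
  have hσker : ∀ x, σ x = 0 ↔ C.j p q x ∈ C.B m p q := fun x =>
    Submodule.Quotient.mk_eq_zero ((C.B m p q).submoduleOf (C.Z m p q))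
  have hτker : ∀ x, τ x = 0 ↔ T x ∈ C.im (p + 1) 0 (p + q) := fun x =>
    Submodule.Quotient.mk_eq_zero ((C.im (p + 1) 0 (p + q)).submoduleOf (C.im p 0 (p + q)))
  have hkr : C.kr m p q = LinearMap.ker T := by
    rw [C.kr_eq_of_le q hp]
    exact C.kr_eq_ker _ _
  have hker : LinearMap.ker σ = LinearMap.ker τ := by
    ext x
    rw [LinearMap.mem_ker, LinearMap.mem_ker, hσker, hτker, B, hkr]
    constructor
    · rintro ⟨z, hz, hzx⟩
      have hz' : T z = 0 := hz
      have h1 : C.j p q (x - z) = 0 := by rw [map_sub, hzx, sub_self]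
      have h2 : T (x - z) = T x := by rw [map_sub, hz', sub_zero]
      rw [← h2]
      obtain _ | q := q
      · have : x - z = 0 := C.j_injective p (h1.trans (map_zero _).symm)
        rw [this, map_zero]
        exact zero_mem _
      · obtain ⟨y, hy⟩ := (C.exact_i_j p q _).1 h1
        rw [C.im_eq_range (p' := p + 1) (q' := q) (by omega) (by omega)]
        exact ⟨y, by rw [iter_succ', hy]⟩
    · intro hx
      obtain _ | q := q
      · rw [C.im_eq_bot (by omega)] at hx
        exact ⟨x, hx, rfl⟩
      · rw [C.im_eq_range (p' := p + 1) (q' := q) (by omega) (by omega)] at hx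
        obtain ⟨y, hy⟩ := hx
        rw [iter_succ'] at hy
        refine ⟨x - C.i p q y, ?_, by rw [map_sub, C.j_i, sub_zero]⟩
        change T (x - C.i p q y) = 0
        rw [map_sub, sub_eq_zero]
        exact hy.symm
  exact ⟨(σ.quotKerEquivOfSurjective hσ).symm ≪≫ₗ Submodule.quotEquivOfEq _ _ hker ≪≫ₗ
    τ.quotKerEquivOfSurjective hτ⟩

/-- The spectral sequence of a first-quadrant exact couple converges to `D^{0,n}`, filtered by the
images of the iterates of `i`. -/
noncomputable def convergesTo : ConvergesTo C.spectralSequence (fun n => C.D 0 n) where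
  F n p := C.im p 0 n
  antitone n := C.im_antitone 0 n
  F_zero _ := rfl
  F_succ n := C.im_eq_bot n.lt_succ_self
  iso p q r hr hp hq :=
    (C.nonempty_page_equiv (m := (r - 1).toNat) (by omega) (by omega)).some

lemma range_j_eq_ker (p : ℕ) : LinearMap.range (C.j p 0) =
    LinearMap.ker ((C.j (p + 1) 0).comp (C.del p 0)) := by
  rw [LinearMap.ker_comp, LinearMap.ker_eq_bot.2 (C.j_injective _), Submodule.comap_bot]
  exact (C.exact_j_del p 0).linearMap_ker_eq.symm

section Degenerate

variable (hE : ∀ p q, Subsingleton (C.E p (q + 1)))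

include hE

lemma iter_surjective_of_subsingleton : ∀ {m p q p' q' : ℕ} (hp : p + m = p') (hq : q' + m = q),
    Function.Surjective (C.iter m hp hq)
  | 0, p, q, p', q', hp, hq => by
    obtain rfl : p = p' := hp
    obtain rfl : q' = q := hq
    exact Function.surjective_id
  | _ + 1, _, 0, _, _, _, hq => absurd hq (Nat.succ_ne_zero _)
  | m + 1, p, q + 1, p', q', hp, hq => by
    intro y
    obtain ⟨z, rfl⟩ := (C.exact_i_j p q y).1 (Subsingleton.elim _ _)
    obtain ⟨w, rfl⟩ := iter_surjective_of_subsingleton (m := m) (p' := p') (q' := q')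
      (by omega) (by omega) z
    exact ⟨w, rfl⟩

/-- Only the first factor of the composite `D^{p+1,0} → D^{p,1} → ⋯` fails to be injective. -/
lemma ker_iter_of_subsingleton : ∀ {m p q p' q' : ℕ} (hp : p + (m + 1) = p' + 1)
    (hq : q' + (m + 1) = q),
    LinearMap.ker (C.iter (m + 1) hp hq) = LinearMap.range (C.del p' q')
  | 0, p, q, p', q', hp, hq => by
    obtain rfl : p = p' := by omega
    obtain rfl : q' + 1 = q := hq
    exact (C.exact_del_i p q').linearMap_ker_eq
  | _ + 1, _, 0, _, _, _, hq => absurd hq (Nat.succ_ne_zero _)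
  | m + 1, p, q + 1, p', q', hp, hq => by
    rw [← ker_iter_of_subsingleton (m := m) (p := p + 1) (q := q) (by omega) (by omega)]
    ext x
    refine ⟨fun hx => ?_, fun hx => ?_⟩
    · obtain ⟨y, hy⟩ := (C.exact_del_i p q _).1 hx
      obtain _ | q := q
      · omega
      · rw [LinearMap.mem_ker, ← hy, Subsingleton.elim y 0, map_zero]
    · rw [LinearMap.mem_ker] at hx ⊢
      rw [iter_succ, hx, map_zero]

/-- If `E^{p,q} = 0` for `q > 0`, the abutment `D^{0,p}` is the homology at `E^{p,0}` of
`j ∘ del`.  The complex is given up to an isomorphism `e`, to allow for another universe. -/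
lemma nonempty_homology_equiv {K : CochainComplex (ModuleCat.{w} k) ℕ}
    (e : ∀ p, C.E p 0 ≃ₗ[k] K.X p)
    (he : ∀ p (x : C.E p 0), K.d p (p + 1) (e p x) = e (p + 1) (C.j (p + 1) 0 (C.del p 0 x)))
    (p : ℕ) : Nonempty (K.homology p ≃ₗ[k] C.D 0 p) := by
  let T : C.D p 0 →ₗ[k] C.D 0 p := C.iter p (zero_add p) (zero_add p)
  have hT : Function.Surjective T := C.iter_surjective_of_subsingleton hE _ _
  let π : C.D p 0 →ₗ[k] (K.sc p).X₂ := (e p).toLinearMap.comp (C.j p 0)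
  have hg : LinearMap.range π = LinearMap.ker (K.sc p).g.hom := by
    have hn : (ComplexShape.up ℕ).next p = p + 1 := ComplexShape.next_eq' _ rfl
    have h1 : LinearMap.ker (K.sc p).g.hom = LinearMap.ker (K.d p (p + 1)).hom := by
      change LinearMap.ker (K.d p ((ComplexShape.up ℕ).next p)).hom = _
      rw [hn]
    refine Eq.trans (?_ : LinearMap.range ((e p).toLinearMap.comp (C.j p 0)) = _) h1.symm
    rw [LinearMap.range_comp, C.range_j_eq_ker]
    ext x
    obtain ⟨x, rfl⟩ := (e p).surjective x
    have h2 : (K.d p (p + 1)).hom (e p x) = _ := he p x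
    rw [LinearMap.mem_ker, h2]
    simp
  have hf : (LinearMap.range (K.sc p).f.hom).comap π = LinearMap.ker T := by
    obtain _ | p := p
    · have h0 : (K.sc 0).f = 0 := K.shape _ _ (by simp)
      have h1 : LinearMap.ker T = ⊥ := LinearMap.ker_id
      rw [h0, h1, ModuleCat.hom_zero, LinearMap.range_zero, Submodule.comap_bot]
      exact LinearMap.ker_eq_bot.2 ((e 0).injective.comp (C.j_injective 0))
    · have hn : (ComplexShape.up ℕ).prev (p + 1) = p := ComplexShape.prev_eq' _ rfl
      have h1 : LinearMap.range (K.sc (p + 1)).f.hom = LinearMap.range (K.d p (p + 1)).hom := by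
        change LinearMap.range (K.d ((ComplexShape.up ℕ).prev (p + 1)) (p + 1)).hom = _
        rw [hn]
      rw [h1]
      have h2 : LinearMap.ker T = LinearMap.range (C.del p 0) :=
        C.ker_iter_of_subsingleton hE _ _
      rw [h2]
      ext x
      constructor
      · rintro ⟨y, hy⟩
        obtain ⟨y, rfl⟩ := (e p).surjective y
        have h3 : (K.d p (p + 1)).hom (e p y) = _ := he p y
        rw [h3] at hy
        exact ⟨y, C.j_injective _ ((e (p + 1)).injective hy)⟩
      · rintro ⟨y, rfl⟩
        exact ⟨e p y, he p y⟩
  exact ⟨homologyEquivOfSurjective (K.sc p) (LinearMap.ker T) π hg hf ≪≫ₗ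
    T.quotKerEquivOfSurjective hT⟩

end Degenerate

end ExactCouple

/-! ### The exact couple of a resolution -/

section Resolution

universe w' v' u'

variable {𝒜 : Type u'} [Category.{v'} 𝒜] [Abelian 𝒜]

/-- A right resolution `0 → N → K⁰ → K¹ → ⋯` of an object of an abelian category. -/
structure RightResolution (N : 𝒜) where
  K : CochainComplex 𝒜 ℕ
  ε : N ⟶ K.X 0
  mono : Mono ε
  ε_d : ε ≫ K.d 0 1 = 0
  exact_zero : (ShortComplex.mk ε (K.d 0 1) ε_d).Exact
  exact_succ : ∀ p, (ShortComplex.mk (K.d p (p + 1)) (K.d (p + 1) (p + 2))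
    (K.d_comp_d _ _ _)).Exact

namespace RightResolution

variable {N : 𝒜} (R : RightResolution N)

/-- The cosyzygies: `N` itself in degree `0`, and the image of `K^p → K^{p+1}` in degree `p + 1`. -/
noncomputable def cosyzygy : ℕ → 𝒜
  | 0 => N
  | p + 1 => image (R.K.d p (p + 1))

/-- The inclusion of a cosyzygy. -/
noncomputable def incl : ∀ p, R.cosyzygy p ⟶ R.K.X p
  | 0 => R.ε
  | p + 1 => image.ι (R.K.d p (p + 1))

/-- The projection to the next cosyzygy. -/
noncomputable def proj (p : ℕ) : R.K.X p ⟶ R.cosyzygy (p + 1) :=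
  factorThruImage (R.K.d p (p + 1))

instance mono_incl : ∀ p, Mono (R.incl p)
  | 0 => R.mono
  | p + 1 => inferInstanceAs (Mono (image.ι (R.K.d p (p + 1))))

instance epi_proj (p : ℕ) : Epi (R.proj p) :=
  inferInstanceAs (Epi (factorThruImage (R.K.d p (p + 1))))

lemma proj_incl (p : ℕ) : R.proj p ≫ R.incl (p + 1) = R.K.d p (p + 1) :=
  image.fac _

lemma incl_d : ∀ p, R.incl p ≫ R.K.d p (p + 1) = 0
  | 0 => R.ε_d
  | p + 1 => by
    rw [← cancel_epi (R.proj p), ← Category.assoc, proj_incl, R.K.d_comp_d, comp_zero]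

lemma exact_incl_d : ∀ p, (ShortComplex.mk (R.incl p) (R.K.d p (p + 1)) (R.incl_d p)).Exact
  | 0 => R.exact_zero
  | p + 1 => by
    let φ : ShortComplex.mk (R.K.d p (p + 1)) (R.K.d (p + 1) (p + 2)) (R.K.d_comp_d _ _ _) ⟶
        ShortComplex.mk (R.incl (p + 1)) (R.K.d (p + 1) (p + 2)) (R.incl_d (p + 1)) :=
      { τ₁ := R.proj p
        τ₂ := 𝟙 _
        τ₃ := 𝟙 _
        comm₁₂ := (R.proj_incl p).trans (Category.comp_id _).symm
        comm₂₃ := (Category.id_comp _).trans (Category.comp_id _).symm }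
    have : Epi φ.τ₁ := R.epi_proj p
    have : IsIso φ.τ₂ := inferInstanceAs (IsIso (𝟙 _))
    have : Mono φ.τ₃ := inferInstanceAs (Mono (𝟙 _))
    exact (ShortComplex.exact_iff_of_epi_of_isIso_of_mono φ).1 (R.exact_succ p)

lemma incl_proj (p : ℕ) : R.incl p ≫ R.proj p = 0 := by
  rw [← cancel_mono (R.incl (p + 1)), Category.assoc, proj_incl, incl_d, zero_comp]

/-- The short complex `Z^p → K^p → Z^{p+1}` of cosyzygies. -/
noncomputable abbrev cosyzygySequence (p : ℕ) : ShortComplex 𝒜 :=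
  ShortComplex.mk (R.incl p) (R.proj p) (R.incl_proj p)

lemma shortExact (p : ℕ) : (R.cosyzygySequence p).ShortExact where
  exact := by
    let φ : R.cosyzygySequence p ⟶
        ShortComplex.mk (R.incl p) (R.K.d p (p + 1)) (R.incl_d p) :=
      { τ₁ := 𝟙 _
        τ₂ := 𝟙 _
        τ₃ := R.incl (p + 1)
        comm₁₂ := (Category.id_comp _).trans (Category.comp_id _).symm
        comm₂₃ := (Category.id_comp _).trans (R.proj_incl p).symm }
    have : Epi φ.τ₁ := inferInstanceAs (Epi (𝟙 _))
    have : IsIso φ.τ₂ := inferInstanceAs (IsIso (𝟙 _))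
    have : Mono φ.τ₃ := R.mono_incl (p + 1)
    exact (ShortComplex.exact_iff_of_epi_of_isIso_of_mono φ).2 (R.exact_incl_d p)
  mono_f := R.mono_incl p
  epi_g := R.epi_proj p

open Abelian

/-- The long exact sequences of `Ext(M, -)` for the short exact sequences of cosyzygies. -/
noncomputable def exactCouple (k : Type t) [Field k] [Linear k 𝒜] [HasExt.{v} 𝒜] (M : 𝒜) :
    ExactCouple.{v, t} k where
  D p q := Ext M (R.cosyzygy p) q
  E p q := Ext M (R.K.X p) q
  i p _ := (R.shortExact p).extClass.postcompOfLinear k M rfl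
  j p q := (Ext.mk₀ (R.incl p)).postcompOfLinear k M (add_zero q)
  del p q := (Ext.mk₀ (R.proj p)).postcompOfLinear k M (add_zero q)
  exact_i_j p q := fun x =>
    ⟨fun h => Ext.covariant_sequence_exact₁ M (R.shortExact p) x h rfl, fun ⟨y, hy⟩ => by
      rw [← hy]
      exact Ext.comp_assoc_of_third_deg_zero _ _ _ rfl |>.trans (by
        rw [(R.shortExact p).extClass_comp, Ext.comp_zero])⟩
  j_injective p := Ext.postcomp_mk₀_injective_of_mono M (R.incl p)
  exact_j_del p q := fun x =>
    ⟨fun h => Ext.covariant_sequence_exact₂ M (R.shortExact p) x h, fun ⟨y, hy⟩ => by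
      rw [← hy]
      exact (Ext.comp_assoc_of_third_deg_zero _ _ _ _).trans (by
        rw [Ext.mk₀_comp_mk₀, R.incl_proj, Ext.mk₀_zero, Ext.comp_zero _ _ _ _ (add_zero q)])⟩
  exact_del_i p q := fun x =>
    ⟨fun h => Ext.covariant_sequence_exact₃ M (R.shortExact p) x rfl h, fun ⟨y, hy⟩ => by
      rw [← hy]
      exact (Ext.comp_assoc_of_second_deg_zero _ _ _ _).trans (by
        rw [(R.shortExact p).comp_extClass, Ext.comp_zero _ _ _ _ rfl])⟩

lemma exactCouple_j_del (k : Type t) [Field k] [Linear k 𝒜] [HasExt.{v} 𝒜] (M : 𝒜) (p q : ℕ)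
    (x : Ext M (R.K.X p) q) :
    (R.exactCouple k M).j (p + 1) q ((R.exactCouple k M).del p q x) =
      x.comp (Ext.mk₀ (R.K.d p (p + 1))) (add_zero q) := by
  refine (Ext.comp_assoc_of_third_deg_zero x (Ext.mk₀ (R.proj p)) (Ext.mk₀ (R.incl (p + 1)))
    (add_zero q)).trans ?_
  rw [Ext.mk₀_comp_mk₀, proj_incl]

lemma linearEquiv₀_comp_mk₀ (k : Type t) [Field k] [Linear k 𝒜] [HasExt.{v} 𝒜] {M N N' : 𝒜}
    (x : Ext M N 0) (f : N ⟶ N') :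
    Ext.linearEquiv₀ (R := k) (x.comp (Ext.mk₀ f) (add_zero 0)) =
      Ext.linearEquiv₀ (R := k) x ≫ f := by
  obtain ⟨g, rfl⟩ := (Ext.linearEquiv₀ (R := k)).symm.surjective x
  rw [LinearEquiv.apply_symm_apply, ← LinearEquiv.eq_symm_apply, Ext.linearEquiv₀_symm_apply,
    Ext.linearEquiv₀_symm_apply, Ext.mk₀_comp_mk₀]

/-- A resolution `K` of `N` with `Ext^q(M, K^p) = 0` for `q > 0` computes `Ext(M, N)`. -/
theorem nonempty_homology_equiv (k : Type t) [Field k] [Linear k 𝒜] [HasExt.{v} 𝒜] (M : 𝒜)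
    (hE : ∀ p q (x : Ext M (R.K.X p) (q + 1)), x = 0) (p : ℕ) :
    Nonempty (((((linearCoyoneda k 𝒜).obj (Opposite.op M)).mapHomologicalComplex _).obj
      R.K).homology p ≃ₗ[k] Ext M N p) :=
  (R.exactCouple k M).nonempty_homology_equiv
    (fun p q => ⟨fun x y => (hE p q x).trans (hE p q y).symm⟩)
    (K := (((linearCoyoneda k 𝒜).obj (Opposite.op M)).mapHomologicalComplex _).obj R.K)
    (fun _ => Ext.linearEquiv₀)
    (fun p x => ((congrArg _ (R.exactCouple_j_del k M p 0 x)).trans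
      (linearEquiv₀_comp_mk₀ k x (R.K.d p (p + 1)))).symm) p

end RightResolution

end Resolution

namespace Qcoh

variable {k : Type t} [Field k] {I : Type w} [SemilatticeInf I] {X : NCScheme.{w, u, t} k I}

/-! ### Componentwise exactness -/

lemma exact_of_app (S : ShortComplex (Qcoh X))
    (h : ∀ i (x : S.X₂.obj i), S.g.app i x = 0 → ∃ y, S.f.app i y = x) : S.Exact := by
  rw [ShortComplex.exact_iff_isZero_homology, IsZero.iff_id_eq_zero]
  refine hom_ext fun i => ?_
  have h1 : (S.map (ev X i)).Exact := (ShortComplex.moduleCat_exact_iff _).2 (h i)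
  have h2 : IsZero ((ev X i).obj S.homology) :=
    ((ShortComplex.exact_iff_isZero_homology _).1 h1).of_iso (S.mapHomologyIso (ev X i)).symm
  exact h2.eq_of_src _ _

lemma mono_of_app {M N : Qcoh X} (f : M ⟶ N) (h : ∀ i, Function.Injective (f.app i)) :
    Mono f where
  right_cancellation g g' hg := hom_ext fun i => by
    have := (ModuleCat.mono_iff_injective _).2 (h i)
    rw [← cancel_mono (f.app i)]
    exact congrArg (fun f => Hom.app f i) hg

lemma epi_of_app {M N : Qcoh X} (f : M ⟶ N) (h : ∀ i, Function.Surjective (f.app i)) :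
    Epi f where
  left_cancellation g g' hg := hom_ext fun i => by
    have := (ModuleCat.epi_iff_surjective _).2 (h i)
    rw [← cancel_epi (f.app i)]
    exact congrArg (fun f => Hom.app f i) hg

/-! ### The modules `[M_s]` of a quasi-coherent module -/

section Bracket

variable (M : Qcoh X)

lemma res_refl {i : I} (m : M.obj i) : M.res le_rfl m = m :=
  (M.ψ_refl i m 1).trans (one_smul _ m)

lemma res_bijective {i j : I} (h : i ≤ j) (h' : j ≤ i) : Function.Bijective (M.res h) :=
  Function.bijective_iff_has_inverse.2 ⟨M.res h',
    fun m => (M.res_res h' h m).trans (M.res_refl m),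
    fun m => (M.res_res h h' m).trans (M.res_refl m)⟩

/-- The gluing isomorphism `[M_s]_i = M_s ⊗ A_{i ∩ s} ≅ M_{i ∩ s}`. -/
noncomputable def bracketEquiv (s i : I) : bracketObj (M.obj s) i ≃+ M.obj (i ⊓ s) :=
  (M.ψ (inf_le_right : i ⊓ s ≤ s)).toLinearEquiv.toAddEquiv

lemma bracketEquiv_tmul (s i : I) (m : M.obj s) (a : X.A (i ⊓ s)) :
    M.bracketEquiv s i (bracketTmul _ i m a) = op a • M.res inf_le_right m :=
  M.ψ_tmul _ m a

lemma bracketEquiv_smul (s i : I) (b : X.A i) (x : bracketObj (M.obj s) i) :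
    M.bracketEquiv s i (op b • x) = op (X.ρ (inf_le_left : i ⊓ s ≤ i) b) • M.bracketEquiv s i x :=
  (M.ψ (inf_le_right : i ⊓ s ≤ s)).hom.hom.map_smul (op (X.ρ (inf_le_left : i ⊓ s ≤ i) b)) x

lemma bracketEquiv_bracketMapAdd {s s' : I} (h : s' ≤ s) (i : I) (x : bracketObj (M.obj s) i) :
    M.bracketEquiv s' i (M.bracketMapAdd h i x) =
      M.res (inf_le_inf_left i h) (M.bracketEquiv s i x) := by
  induction x using bracketObj_induction with
  | h0 => simp
  | h1 m a =>
    rw [bracketMapAdd_tmul, bracketEquiv_tmul, bracketEquiv_tmul, res_smul, res_res, res_res]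
  | h2 x y hx hy => rw [map_add, map_add, map_add, map_add, hx, hy]

lemma bracketEquiv_bracketRes (s : I) {i j : I} (h : i ≤ j) (x : bracketObj (M.obj s) j) :
    M.bracketEquiv s i (bracketRes (M.obj s) h x) =
      M.res (inf_le_inf_right s h) (M.bracketEquiv s j x) := by
  induction x using bracketObj_induction with
  | h0 => simp
  | h1 m a =>
    rw [bracketRes_tmul, bracketEquiv_tmul, bracketEquiv_tmul, res_smul, res_res]
  | h2 x y hx hy => rw [map_add, map_add, map_add, map_add, hx, hy]

lemma bracketMapAdd_bijective {s s' : I} (h : s' ≤ s) {i : I} (hi : i ⊓ s ≤ s') :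
    Function.Bijective (M.bracketMapAdd h i) := by
  have h1 : (M.bracketEquiv s' i) ∘ (M.bracketMapAdd h i) =
      (M.res (inf_le_inf_left i h)) ∘ (M.bracketEquiv s i) :=
    funext (M.bracketEquiv_bracketMapAdd h i)
  rw [← (M.bracketEquiv s' i).bijective.of_comp_iff', h1]
  exact (M.res_bijective _ (le_inf inf_le_left hi)).comp (M.bracketEquiv s i).bijective

variable [X.HasInter]

/-- The natural homomorphism `M → [M_s]`, given at `i` by the restriction `M_i → M_{i ∩ s}`. -/
noncomputable def unit (s : I) : M ⟶ bracket (M.obj s) where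
  app i := ModuleCat.ofHom (X := M.obj i) (Y := bracketObj (M.obj s) i)
    { toFun := fun m => (M.bracketEquiv s i).symm (M.res inf_le_left m)
      map_add' := fun m m' => by rw [map_add, map_add]
      map_smul' := fun b m => by
        rw [AddEquiv.symm_apply_eq]
        exact (M.res_smul _ m b.unop).trans (((M.bracketEquiv_smul s i b.unop _).trans
          (congrArg _ (AddEquiv.apply_symm_apply _ _))).symm) }
  comm {i j} h := by
    refine baseChange_hom_ext _ fun m b => (M.bracketEquiv s i).injective ?_
    refine (congrArg (fun y => M.bracketEquiv s i (bracketψHom (M.obj s) h y))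
      (baseChange_map_tmul (X.ρ h) _ m b)).trans ?_
    change M.bracketEquiv s i (op b • bracketRes (M.obj s) h
      ((M.bracketEquiv s j).symm (M.res inf_le_left m))) =
      M.bracketEquiv s i ((M.bracketEquiv s i).symm
        (M.res inf_le_left ((M.ψ h).hom (BaseChange.tmul (X.ρ h) m b))))
    rw [bracketEquiv_smul, bracketEquiv_bracketRes, AddEquiv.apply_symm_apply,
      AddEquiv.apply_symm_apply, ψ_tmul, res_smul, res_res, res_res]

lemma bracketEquiv_unit (s i : I) (m : M.obj i) :
    M.bracketEquiv s i ((M.unit s).app i m) = M.res inf_le_left m :=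
  AddEquiv.apply_symm_apply _ _

lemma unit_bracketMap {s s' : I} (h : s' ≤ s) : M.unit s ≫ M.bracketMap h = M.unit s' := by
  refine hom_ext fun i => ModuleCat.hom_ext (LinearMap.ext fun m =>
    (M.bracketEquiv s' i).injective ?_)
  refine (M.bracketEquiv_bracketMapAdd h i ((M.unit s).app i m)).trans ?_
  refine Eq.trans ?_ (M.bracketEquiv_unit s' i m).symm
  rw [bracketEquiv_unit, res_res]

lemma unit_app_bijective {s i : I} (h : i ≤ s) : Function.Bijective ((M.unit s).app i) :=
  (M.bracketEquiv s i).symm.bijective.comp (M.res_bijective _ (le_inf le_rfl h))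

lemma bracketMap_app_bijective {s s' : I} (h : s' ≤ s) {i : I} (hi : i ⊓ s ≤ s') :
    Function.Bijective ((M.bracketMap h).app i) :=
  M.bracketMapAdd_bijective h hi

end Bracket

/-! ### Exactness of the Čech complex -/

section Faces

variable {d p : ℕ}

lemma range_face (K : Fin (p + 2) ↪o Fin d) (a : Fin (p + 2)) :
    Set.range (face K a) = Set.range K \ {K a} := by
  ext j
  constructor
  · rintro ⟨l, rfl⟩
    exact ⟨⟨_, rfl⟩, fun h => Fin.succAbove_ne a l (K.injective h)⟩
  · rintro ⟨⟨l, rfl⟩, hl⟩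
    have : l ≠ a := fun h => hl (congrArg K h)
    obtain ⟨l, rfl⟩ := Fin.exists_succAbove_eq this
    exact ⟨l, rfl⟩

lemma not_mem_range_face (K : Fin (p + 2) ↪o Fin d) (a : Fin (p + 2)) :
    K a ∉ Set.range (face K a) := by
  rw [range_face]
  exact fun h => h.2 rfl

lemma mem_range_face (K : Fin (p + 2) ↪o Fin d) {a b : Fin (p + 2)} (h : b ≠ a) :
    K a ∈ Set.range (face K b) := by
  rw [range_face]
  exact ⟨⟨a, rfl⟩, fun h' => h (K.injective h').symm⟩

/-- An index not occurring in `J` can be inserted into `J`. -/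
lemma exists_face_eq (J : Fin (p + 1) ↪o Fin d) {j : Fin d} (hj : j ∉ Set.range J) :
    ∃ (K : Fin (p + 2) ↪o Fin d) (a : Fin (p + 2)), K a = j ∧ face K a = J := by
  classical
  let s : Finset (Fin d) := insert j (Finset.univ.map J.toEmbedding)
  have hs : s.card = p + 2 := by
    rw [Finset.card_insert_of_notMem, Finset.card_map, Finset.card_fin]
    simpa using hj
  let K := s.orderEmbOfFin hs
  have hK : Set.range K = insert j (Set.range J) := by
    rw [Finset.range_orderEmbOfFin]
    simp [s]
  obtain ⟨a, ha⟩ : j ∈ Set.range K := by rw [hK]; exact Set.mem_insert _ _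
  refine ⟨K, a, ha, OrderEmbedding.range_inj.1 ?_⟩
  rw [range_face, ha, hK, Set.insert_sdiff_self_of_notMem hj]

/-- The insertion of an index is unique. -/
lemma eq_of_face_eq {K K' : Fin (p + 2) ↪o Fin d} {a a' : Fin (p + 2)} (h : K a = K' a')
    (hf : face K a = face K' a') : K = K' ∧ a = a' := by
  have hK : K = K' := by
    refine OrderEmbedding.range_inj.1 ?_
    have h1 := range_face K a
    rw [hf, range_face, h] at h1
    have h2 : K' a' ∈ Set.range K := ⟨a, h⟩
    have h3 : K' a' ∈ Set.range K' := ⟨a', rfl⟩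
    rw [← Set.insert_sdiff_self_of_mem h2, ← h1, Set.insert_sdiff_self_of_mem h3]
  subst hK
  exact ⟨rfl, K.injective h⟩

end Faces

section Cech

variable (N : Qcoh X) {d : ℕ} (e : Fin d ≃ I)

lemma inter_le {p : ℕ} (J : Fin (p + 1) ↪o Fin d) (l : Fin (p + 1)) : inter e J ≤ e (J l) :=
  Finset.inf'_le (fun l => e (J l)) (Finset.mem_univ l)

/-- Omitting the index of `i` does not change the intersection with `i`. -/
lemma inf_inter_face_le {p : ℕ} (K : Fin (p + 2) ↪o Fin d) (a : Fin (p + 2)) :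
    e (K a) ⊓ inter e (face K a) ≤ inter e K := by
  refine Finset.le_inf' _ _ fun l _ => ?_
  obtain rfl | hl := eq_or_ne l a
  · exact inf_le_left
  · obtain ⟨l, rfl⟩ := Fin.exists_succAbove_eq hl
    exact inf_le_right.trans (inter_le e (face K a) l)

lemma sum_app_apply {M M' : Qcoh X} {ι : Type*} (s : Finset ι) (f : ι → (M ⟶ M')) (i : I)
    (x : M.obj i) : (∑ a ∈ s, f a).app i x = ∑ a ∈ s, (f a).app i x :=
  map_sum ({ toFun := fun f => f.app i x, map_zero' := rfl, map_add' := fun _ _ => rfl } :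
    (M ⟶ M') →+ M'.obj i) f s

variable [X.HasInter]

attribute [local instance] Abelian.hasFiniteBiproducts

variable {e N}

lemma cech_ext {p : ℕ} {i : I} {x y : (N.cechX e p).obj i}
    (h : ∀ J, (N.cechπ e J).app i x = (N.cechπ e J).app i y) : x = y := by
  have hx : ∀ x : (N.cechX e p).obj i, x = ∑ J, (biproduct.ι
      (fun J : Fin (p + 1) ↪o Fin d => bracket (N.obj (inter e J))) J).app i
        ((N.cechπ e J).app i x) := by
    intro x
    have h1 := congrArg (fun f => Hom.app f i x) (biproduct.total
      (f := fun J : Fin (p + 1) ↪o Fin d => bracket (N.obj (inter e J))))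
    exact h1.symm.trans (sum_app_apply _ _ i x)
  rw [hx x, hx y]
  exact Finset.sum_congr rfl fun J _ => congrArg _ (h J)

lemma exists_cech {p : ℕ} {i : I}
    (z : ∀ J : Fin (p + 1) ↪o Fin d, (bracket (N.obj (inter e J))).obj i) :
    ∃ x : (N.cechX e p).obj i, ∀ J, (N.cechπ e J).app i x = z J := by
  classical
  refine ⟨∑ J, (biproduct.ι (fun J : Fin (p + 1) ↪o Fin d => bracket (N.obj (inter e J))) J).app i
    (z J), fun J => ?_⟩
  refine (map_sum ((N.cechπ e J).app i).hom _ _).trans ?_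
  rw [Finset.sum_eq_single J]
  · exact congrArg (fun f => Hom.app f i (z J)) (biproduct.ι_π_self
      (fun J : Fin (p + 1) ↪o Fin d => bracket (N.obj (inter e J))) J)
  · intro J' _ hJ
    exact congrArg (fun f => Hom.app f i (z J')) (biproduct.ι_π_ne
      (fun J : Fin (p + 1) ↪o Fin d => bracket (N.obj (inter e J))) hJ)
  · exact fun h => absurd (Finset.mem_univ _) h

lemma cechπ_cechD {p : ℕ} {i : I} (x : (N.cechX e p).obj i) (K : Fin (p + 2) ↪o Fin d) :
    (N.cechπ e K).app i ((N.cechD e p).app i x) = ∑ a : Fin (p + 2), ((-1) ^ (a : ℕ) : ℤ) •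
      (N.bracketMap (inter_le_face e K a)).app i ((N.cechπ e (face K a)).app i x) := by
  exact (congrArg (fun f => Hom.app f i x) (N.cechD_π e p K)).trans (sum_app_apply _ _ i x)

/-- At `i = i(j)`, a cocycle is determined by its components at tuples containing `j`: the cocycle
condition at the insertion of `j` into `J` expresses the component at `J` by those. -/
lemma eq_zero_of_cocycle {p : ℕ} {j : Fin d} {x : (N.cechX e p).obj (e j)}
    (hx : (N.cechD e p).app (e j) x = 0)
    (h : ∀ J : Fin (p + 1) ↪o Fin d, j ∈ Set.range J → (N.cechπ e J).app (e j) x = 0) : x = 0 := by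
  refine cech_ext fun J => Eq.trans ?_ (map_zero ((N.cechπ e J).app (e j)).hom).symm
  by_cases hJ : j ∈ Set.range J
  · exact h J hJ
  obtain ⟨K, a, rfl, rfl⟩ := exists_face_eq J hJ
  have h1 := cechπ_cechD x K
  rw [Finset.sum_eq_single a, hx] at h1
  · have h2 : (N.bracketMap (inter_le_face e K a)).app (e (K a))
        ((N.cechπ e (face K a)).app (e (K a)) x) = 0 := by
      refine ((Int.isUnit_iff.2 (neg_one_pow_eq_or ℤ (a : ℕ))).smul_eq_zero).1 ?_
      exact h1.symm.trans (map_zero ((N.cechπ e K).app (e (K a))).hom)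
    exact (N.bracketMap_app_bijective (inter_le_face e K a) (inf_inter_face_le e K a)).1
      (h2.trans (map_zero ((N.bracketMap (inter_le_face e K a)).app (e (K a))).hom).symm)
  · intro b _ hb
    rw [h (face K b) (mem_range_face K hb)]
    exact (congrArg _ (map_zero ((N.bracketMap (inter_le_face e K b)).app (e (K a))).hom)).trans
      (smul_zero _)
  · exact fun h => absurd (Finset.mem_univ _) h

/-- At `i = i(j)`, every cochain agrees with a coboundary at all tuples containing `j`. -/
lemma exists_cechD_eq {p : ℕ} {j : Fin d} (x : (N.cechX e (p + 1)).obj (e j)) :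
    ∃ y : (N.cechX e p).obj (e j), ∀ K : Fin (p + 2) ↪o Fin d, j ∈ Set.range K →
      (N.cechπ e K).app (e j) ((N.cechD e p).app (e j) y) = (N.cechπ e K).app (e j) x := by
  -- The component of `y` at `J` is, up to sign, that of `x` at the insertion of `j` into `J`.
  have key : ∀ J : Fin (p + 1) ↪o Fin d, ∃ z : (bracket (N.obj (inter e J))).obj (e j),
      (j ∈ Set.range J → z = 0) ∧
      ∀ (K : Fin (p + 2) ↪o Fin d) (a : Fin (p + 2)) (h : inter e K ≤ inter e J),
        K a = j → face K a = J →
        (N.bracketMap h).app (e j) z = ((-1) ^ (a : ℕ) : ℤ) • (N.cechπ e K).app (e j) x := by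
    intro J
    by_cases hJ : j ∈ Set.range J
    · refine ⟨0, fun _ => rfl, ?_⟩
      rintro K a h rfl rfl
      exact absurd hJ (not_mem_range_face K a)
    · obtain ⟨K, a, rfl, rfl⟩ := exists_face_eq J hJ
      obtain ⟨z, hz⟩ := (N.bracketMap_app_bijective (inter_le_face e K a)
        (inf_inter_face_le e K a)).2 (((-1) ^ (a : ℕ) : ℤ) • (N.cechπ e K).app (e (K a)) x)
      refine ⟨z, fun h => absurd h hJ, fun K' a' h hK hf => ?_⟩
      obtain ⟨rfl, rfl⟩ := eq_of_face_eq hK hf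
      exact hz
  choose z hz hz' using key
  obtain ⟨y, hy⟩ := exists_cech z
  refine ⟨y, ?_⟩
  rintro K ⟨a, rfl⟩
  rw [cechπ_cechD, Finset.sum_eq_single a, hy, hz' _ K a _ rfl rfl, smul_smul, ← mul_pow]
  · simp
  · intro b _ hb
    rw [hy, hz _ (mem_range_face K hb)]
    exact (congrArg _ (map_zero ((N.bracketMap (inter_le_face e K b)).app (e (K a))).hom)).trans
      (smul_zero _)
  · exact fun h => absurd (Finset.mem_univ _) h

lemma cechD_cechD_apply {p : ℕ} {i : I} (y : (N.cechX e p).obj i) :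
    (N.cechD e (p + 1)).app i ((N.cechD e p).app i y) = 0 :=
  congrArg (fun f => Hom.app f i y) (N.cechD_comp e p)

lemma cech_exact {p : ℕ} {i : I} (x : (N.cechX e (p + 1)).obj i)
    (hx : (N.cechD e (p + 1)).app i x = 0) :
    ∃ y, (N.cechD e p).app i y = x := by
  obtain ⟨j, rfl⟩ := e.surjective i
  obtain ⟨y, hy⟩ := exists_cechD_eq x
  refine ⟨y, sub_eq_zero.1 (eq_zero_of_cocycle ?_ fun K hK => ?_)⟩
  · refine (map_sub ((N.cechD e (p + 1)).app (e j)).hom _ _).trans ?_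
    exact sub_eq_zero.2 ((cechD_cechD_apply y).trans hx.symm)
  · refine (map_sub ((N.cechπ e K).app (e j)).hom _ _).trans ?_
    exact sub_eq_zero.2 (hy K hK)

variable (e N)

/-- The augmentation `N → Č⁰(N)`. -/
noncomputable def cechε : N ⟶ N.cechX e 0 :=
  biproduct.lift fun J => N.unit (inter e J)

lemma cechε_π (J : Fin 1 ↪o Fin d) : N.cechε e ≫ N.cechπ e J = N.unit (inter e J) :=
  biproduct.lift_π _ _

lemma cechε_cechD : N.cechε e ≫ N.cechD e 0 = 0 := by
  refine biproduct.hom_ext _ _ fun J => ?_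
  change (N.cechε e ≫ N.cechD e 0) ≫ N.cechπ e J = 0 ≫ N.cechπ e J
  rw [Category.assoc, cechD_π, zero_comp, Fin.sum_univ_two, Preadditive.comp_add,
    Preadditive.comp_zsmul, Preadditive.comp_zsmul, ← Category.assoc, ← Category.assoc,
    cechε_π, cechε_π, unit_bracketMap, unit_bracketMap]
  simp

variable {e N}

lemma cechπ_cechε {i : I} (m : N.obj i) (J : Fin 1 ↪o Fin d) :
    (N.cechπ e J).app i ((N.cechε e).app i m) = (N.unit (inter e J)).app i m :=
  congrArg (fun f => Hom.app f i m) (N.cechε_π e J)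

lemma le_inter_of_mem_range {j : Fin d} {J : Fin 1 ↪o Fin d} (hJ : j ∈ Set.range J) :
    e j ≤ inter e J := by
  obtain ⟨a, rfl⟩ := hJ
  refine Finset.le_inf' _ _ fun l _ => ?_
  rw [Subsingleton.elim a l]

/-- The `1`-tuple with entry `j`. -/
def singleTuple (j : Fin d) : Fin 1 ↪o Fin d :=
  OrderEmbedding.ofStrictMono (fun _ => j) (Subsingleton.strictMono _)

lemma eq_singleTuple {j : Fin d} {J : Fin 1 ↪o Fin d} (hJ : j ∈ Set.range J) :
    J = singleTuple j := by
  obtain ⟨a, rfl⟩ := hJ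
  exact RelEmbedding.ext fun l => congrArg J (Subsingleton.elim l a)

lemma mem_range_singleTuple (j : Fin d) : j ∈ Set.range (singleTuple j) := ⟨0, rfl⟩

lemma cechε_injective (i : I) : Function.Injective ((N.cechε e).app i) := by
  obtain ⟨j, rfl⟩ := e.surjective i
  intro m m' h
  refine (N.unit_app_bijective (le_inter_of_mem_range (mem_range_singleTuple j))).1 ?_
  rw [← cechπ_cechε, ← cechπ_cechε, h]

lemma cech_exact_zero {i : I} (x : (N.cechX e 0).obj i) (hx : (N.cechD e 0).app i x = 0) :
    ∃ y, (N.cechε e).app i y = x := by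
  obtain ⟨j, rfl⟩ := e.surjective i
  obtain ⟨y, hy⟩ := (N.unit_app_bijective (le_inter_of_mem_range
    (e := e) (mem_range_singleTuple j))).2 ((N.cechπ e (singleTuple j)).app (e j) x)
  refine ⟨y, sub_eq_zero.1 (eq_zero_of_cocycle ?_ fun K hK => ?_)⟩
  · refine (map_sub ((N.cechD e 0).app (e j)).hom _ _).trans (sub_eq_zero.2 ?_)
    exact (congrArg (fun f => Hom.app f (e j) y) (N.cechε_cechD e)).trans hx.symm
  · refine (map_sub ((N.cechπ e K).app (e j)).hom _ _).trans (sub_eq_zero.2 ?_)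
    obtain rfl := eq_singleTuple hK
    exact (cechπ_cechε y _).trans hy

variable (e N)

lemma cech_d (p : ℕ) : (N.cech e).d p (p + 1) = N.cechD e p :=
  CochainComplex.of_d _ _ _

/-- The Čech complex is a right resolution. -/
noncomputable def cechResolution : RightResolution N where
  K := N.cech e
  ε := N.cechε e
  mono := mono_of_app _ cechε_injective
  ε_d := (congrArg (N.cechε e ≫ ·) (N.cech_d e 0)).trans (N.cechε_cechD e)
  exact_zero := exact_of_app _ fun i x hx =>
    cech_exact_zero x ((congrArg (fun f => Hom.app f i x) (N.cech_d e 0)).symm.trans hx)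
  exact_succ p := exact_of_app _ fun i x hx => by
    obtain ⟨y, hy⟩ := cech_exact x
      ((congrArg (fun f => Hom.app f i x) (N.cech_d e (p + 1))).symm.trans hx)
    exact ⟨y, (congrArg (fun f => Hom.app f i y) (N.cech_d e p)).trans hy⟩

end Cech

end Qcoh

namespace Qcoh

variable {k : Type t} [Field k] {I : Type w} [SemilatticeInf I] {X : NCScheme.{w, u, t} k I}

/-! ### The adjunction between `M ↦ M_s` and `N ↦ [N]` -/

lemma res_naturality {M M' : Qcoh X} (f : M ⟶ M') {i j : I} (h : i ≤ j) (m : M.obj j) :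
    M'.res h (f.app j m) = f.app i (M.res h m) :=
  (congrArg (M'.ψ h).hom (baseChange_map_tmul (X.ρ h) (f.app j) m 1).symm).trans
    (ConcreteCategory.congr_hom (f.comm h) (BaseChange.tmul (X.ρ h) m 1))

section

variable {s : I}

/-- The homomorphism `[N]_i → [N']_i` induced by `g : N → N'`. -/
noncomputable def bracketObjMap {N N' : ModuleCat.{u} (X.A s)ᵐᵒᵖ} (g : N ⟶ N') (i : I) :
    bracketObj N i ⟶ bracketObj N' i :=
  (restr (X.ρ (inf_le_left : i ⊓ s ≤ i))).map
    ((baseChange (X.ρ (inf_le_right : i ⊓ s ≤ s))).map g)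

lemma bracketObjMap_tmul {N N' : ModuleCat.{u} (X.A s)ᵐᵒᵖ} (g : N ⟶ N') (i : I) (m : N)
    (a : X.A (i ⊓ s)) : bracketObjMap g i (bracketTmul N i m a) = bracketTmul N' i (g m) a :=
  baseChange_map_tmul (X.ρ (inf_le_right : i ⊓ s ≤ s)) g m a

lemma bracketRes_bracketObjMap {N N' : ModuleCat.{u} (X.A s)ᵐᵒᵖ} (g : N ⟶ N') {i j : I}
    (h : i ≤ j) (x : bracketObj N j) :
    bracketRes N' h (bracketObjMap g j x) = bracketObjMap g i (bracketRes N h x) := by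
  induction x using bracketObj_induction with
  | h0 => simp
  | h1 m a => rw [bracketObjMap_tmul, bracketRes_tmul, bracketRes_tmul, bracketObjMap_tmul]
  | h2 x y hx hy => rw [map_add, map_add, map_add, map_add, hx, hy]

/-- The homomorphism `[N]_s = N ⊗ A_{s ∩ s} → N`. -/
noncomputable def counit (N : ModuleCat.{u} (X.A s)ᵐᵒᵖ) : bracketObj N s ⟶ N :=
  have h (a : X.A s) : X.ρ (le_inf le_rfl le_rfl : s ≤ s ⊓ s) (X.ρ inf_le_right a) = a := by
    rw [X.ρ_ρ, X.ρ_refl]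
  let L := BaseChange.lift (f := X.ρ (inf_le_right : s ⊓ s ≤ s))
    (N := (restr (X.ρ (le_inf le_rfl le_rfl : s ≤ s ⊓ s))).obj N) (AddMonoidHom.id N)
    (fun a m => (congrArg (fun c => op c • m) (h a)).symm)
  ModuleCat.ofHom (X := bracketObj N s) (Y := N)
    { toFun := fun x => L x
      map_add' := fun x y => L.map_add x y
      map_smul' := fun b x => (L.map_smul (op (X.ρ inf_le_left b.unop)) x).trans
        (congrArg (fun c => op c • (show N from L x)) (h b.unop)) }

lemma counit_tmul (N : ModuleCat.{u} (X.A s)ᵐᵒᵖ) (m : N) (a : X.A (s ⊓ s)) :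
    counit N (bracketTmul N s m a) = op (X.ρ (le_inf le_rfl le_rfl) a) • m := rfl

lemma counit_eq (M : Qcoh X) (x : bracketObj (M.obj s) s) :
    counit (M.obj s) x = M.res (le_inf le_rfl le_rfl) (M.bracketEquiv s s x) := by
  induction x using bracketObj_induction with
  | h0 => simp
  | h1 m a => rw [counit_tmul, bracketEquiv_tmul, res_smul, res_res, res_refl]
  | h2 x y hx hy => rw [map_add, map_add, map_add, hx, hy]

lemma bracketEquiv_naturality {M M' : Qcoh X} (f : M ⟶ M') (i : I)
    (x : bracketObj (M.obj s) i) :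
    M'.bracketEquiv s i (bracketObjMap (f.app s) i x) =
      f.app (i ⊓ s) (M.bracketEquiv s i x) := by
  induction x using bracketObj_induction with
  | h0 => simp
  | h1 m a =>
    rw [bracketObjMap_tmul, bracketEquiv_tmul, bracketEquiv_tmul, map_smul, res_naturality]
  | h2 x y hx hy => rw [map_add, map_add, map_add, map_add, hx, hy]

variable [X.HasInter]

variable (X s) in
/-- The functor `N ↦ [N]` from right `A_s`-modules to quasi-coherent modules. -/
noncomputable def bracketFunctor : ModuleCat.{u} (X.A s)ᵐᵒᵖ ⥤ Qcoh X where
  obj N := bracket N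
  map {N N'} g :=
    { app := bracketObjMap g
      comm := fun {i j} h => by
        refine baseChange_hom_ext _ fun x b => ?_
        refine (congrArg (bracketψHom N' h)
          (baseChange_map_tmul (X.ρ h) (bracketObjMap g j) x b)).trans ?_
        change op b • bracketRes N' h (bracketObjMap g j x) =
          bracketObjMap g i (op b • bracketRes N h x)
        exact (congrArg (op b • ·) (bracketRes_bracketObjMap g h x)).trans
          (map_smul (bracketObjMap g i).hom (op b) (bracketRes N h x)).symm }
  map_id N := hom_ext fun i => (baseChange (X.ρ (inf_le_right : i ⊓ s ≤ s)) ⋙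
    restr (X.ρ (inf_le_left : i ⊓ s ≤ i))).map_id N
  map_comp g g' := hom_ext fun i => (baseChange (X.ρ (inf_le_right : i ⊓ s ≤ s)) ⋙
    restr (X.ρ (inf_le_left : i ⊓ s ≤ i))).map_comp g g'

instance : (bracketFunctor X s).Additive where
  map_add := hom_ext fun i => (baseChange (X.ρ (inf_le_right : i ⊓ s ≤ s)) ⋙
    restr (X.ρ (inf_le_left : i ⊓ s ≤ i))).map_add

lemma bracket_res (N : ModuleCat.{u} (X.A s)ᵐᵒᵖ) {i j : I} (h : i ≤ j) (x : bracketObj N j) :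
    (bracket N).res h x = bracketRes N h x :=
  one_smul (X.A i)ᵐᵒᵖ (bracketRes N h x)

lemma unit_bracket_tmul (N : ModuleCat.{u} (X.A s)ᵐᵒᵖ) (i : I) (m : N) (a : X.A (i ⊓ s)) :
    ((bracket N).unit s).app i (bracketTmul N i m a) =
      bracketTmul ((bracket N).obj s) i (bracketTmul N s m 1) a := by
  refine ((bracket N).bracketEquiv s i).injective ?_
  refine ((bracket N).bracketEquiv_unit s i (bracketTmul N i m a)).trans ?_
  refine Eq.trans ?_ ((bracket N).bracketEquiv_tmul s i (bracketTmul N s m 1) a).symm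
  refine (bracket_res N inf_le_left (bracketTmul N i m a)).trans ?_
  refine Eq.trans ?_
    (congrArg (op a • ·) (bracket_res N (inf_le_right : i ⊓ s ≤ s) (bracketTmul N s m 1))).symm
  change _ = op a • bracketRes N (inf_le_right : i ⊓ s ≤ s) (bracketTmul N s m 1)
  rw [bracketRes_tmul, bracketRes_tmul, map_one, bracketObj_smul, one_mul]

variable (X s) in
/-- The functor `N ↦ [N]` is right adjoint to `M ↦ M_s`. -/
noncomputable def bracketAdj : ev X s ⊣ bracketFunctor X s where
  unit :=
    { app := fun M => M.unit s
      naturality := fun M M' f => hom_ext fun i => by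
        refine ModuleCat.hom_ext (LinearMap.ext fun m => (M'.bracketEquiv s i).injective ?_)
        refine (M'.bracketEquiv_unit s i (f.app i m)).trans ?_
        refine (res_naturality f _ m).trans ?_
        refine Eq.trans ?_ (bracketEquiv_naturality f i ((M.unit s).app i m)).symm
        rw [bracketEquiv_unit] }
  counit :=
    { app := fun N => counit N
      naturality := fun N N' g => ModuleCat.hom_ext (LinearMap.ext fun x => by
        change counit N' (bracketObjMap g s x) = g (counit N x)
        induction x using bracketObj_induction with
        | h0 => simp
        | h1 m a => rw [bracketObjMap_tmul, counit_tmul, counit_tmul, map_smul]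
        | h2 x y hx hy => rw [map_add, map_add, map_add, map_add, hx, hy]) }
  left_triangle_components M := ModuleCat.hom_ext (LinearMap.ext fun m => by
    change counit (M.obj s) ((M.unit s).app s m) = m
    refine (counit_eq M ((M.unit s).app s m)).trans ?_
    refine (congrArg _ (M.bracketEquiv_unit s s m)).trans ?_
    exact (M.res_res _ _ m).trans (M.res_refl m))
  right_triangle_components N := hom_ext fun i => ModuleCat.hom_ext (LinearMap.ext fun x => by
    change bracketObjMap (counit N) i (((bracket N).unit s).app i x) = x
    induction x using bracketObj_induction with
    | h0 =>
      exact (congrArg _ (map_zero (((bracket N).unit s).app i).hom)).trans (map_zero _)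
    | h1 m a =>
      rw [unit_bracket_tmul]
      refine (bracketObjMap_tmul (counit N) i (bracketTmul N s m 1) a).trans ?_
      rw [counit_tmul, map_one, MulOpposite.op_one, one_smul]
    | h2 x y hx hy =>
      refine (congrArg _ (map_add (((bracket N).unit s).app i).hom x y)).trans ?_
      exact (map_add (bracketObjMap (counit N) i).hom _ _).trans (congrArg₂ (· + ·) hx hy))

/-- The functor `N ↦ [N]` is exact. -/
lemma bracketFunctor_shortExact {S : ShortComplex (ModuleCat.{u} (X.A s)ᵐᵒᵖ)}
    (hS : S.ShortExact) : (S.map (bracketFunctor X s)).ShortExact := by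
  have h : ∀ i : I, (S.map (baseChange (X.ρ (inf_le_right : i ⊓ s ≤ s)))).ShortExact :=
    fun i => hS.map_of_exact _
  exact
    { exact := exact_of_app _ fun i x hx =>
        (ShortComplex.moduleCat_exact_iff _).1 (h i).exact x hx
      mono_f := mono_of_app _ fun i => (h i).moduleCat_injective_f
      epi_g := epi_of_app _ fun i => (h i).moduleCat_surjective_g }

end

end Qcoh

/-! ### Vanishing of `Ext` for locally free modules -/

open Abelian

/-- Let `G` be an exact right adjoint of an exact functor `F`, and let `F M` be projective.  Then
`Ext^q(M, G N) = 0` for `q > 0`, by dimension shifting along an embedding of `N` into an injective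
object `J`: the object `G J` is injective, and every morphism `M → G (J / N)` lifts to `G J` by
adjunction. -/
lemma ext_rightAdjoint_eq_zero {𝒜 ℬ : Type*} [Category 𝒜] [Category ℬ] [Abelian 𝒜] [Abelian ℬ]
    [EnoughInjectives ℬ] [HasExt.{v} 𝒜] {F : 𝒜 ⥤ ℬ} {G : ℬ ⥤ 𝒜} (adj : F ⊣ G)
    [F.PreservesMonomorphisms] [G.PreservesZeroMorphisms]
    (hG : ∀ {S : ShortComplex ℬ}, S.ShortExact → (S.map G).ShortExact)
    {M : 𝒜} [Projective (F.obj M)] (q : ℕ) :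
    ∀ {N : ℬ} (x : Ext M (G.obj N) (q + 1)), x = 0 := by
  have hS (N : ℬ) : (ShortComplex.mk (G.map (Injective.ι N)) (G.map (cokernel.π (Injective.ι N)))
      (by rw [← G.map_comp, cokernel.condition, G.map_zero])).ShortExact :=
    hG (S := ShortComplex.mk (Injective.ι N) (cokernel.π (Injective.ι N)) (cokernel.condition _))
      { exact := ShortComplex.exact_cokernel _
        mono_f := inferInstanceAs (Mono (Injective.ι N))
        epi_g := inferInstanceAs (Epi (cokernel.π (Injective.ι N))) }
  have hJ (N : ℬ) : Injective (G.obj (Injective.under N)) := adj.map_injective _ inferInstance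
  induction q with
  | zero =>
    intro N x
    obtain ⟨y, rfl⟩ := Ext.covariant_sequence_exact₁ M (hS N) x
      (have := hJ N; Ext.eq_zero_of_injective _) rfl
    obtain ⟨g, rfl⟩ := Ext.homEquiv₀.symm.surjective y
    let g' : M ⟶ G.obj (Injective.under N) := adj.homEquiv _ _
      (Projective.factorThru ((adj.homEquiv _ _).symm g) (cokernel.π (Injective.ι N)))
    have hg : g' ≫ G.map (cokernel.π (Injective.ι N)) = g := by
      rw [← adj.homEquiv_naturality_right, Projective.factorThru_comp, Equiv.apply_symm_apply]
    change (Ext.mk₀ g).comp (hS N).extClass rfl = 0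
    rw [← hg, ← Ext.mk₀_comp_mk₀, Ext.comp_assoc_of_second_deg_zero]
    refine (congrArg (fun z => (Ext.mk₀ g').comp z (zero_add 1)) (hS N).comp_extClass).trans ?_
    exact Ext.comp_zero _ _ _ _ _
  | succ q ih =>
    intro N x
    obtain ⟨y, rfl⟩ := Ext.covariant_sequence_exact₁ M (hS N) x
      (have := hJ N; Ext.eq_zero_of_injective _) rfl
    rw [ih y, Ext.zero_comp]

namespace Qcoh

variable {k : Type t} [Field k] {I : Type w} [SemilatticeInf I] {X : NCScheme.{w, u, t} k I}

lemma IsLocallyFreeOfRank.projective {M : Qcoh X} {r : ℕ} (hM : M.IsLocallyFreeOfRank r) (i : I) :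
    Projective (M.obj i) := by
  obtain ⟨b⟩ := hM i
  exact ModuleCat.projective_of_free b

section

variable {s : I} [X.HasInter]

variable [HasExt.{v} (Qcoh X)] {M : Qcoh X}

lemma ext_bracket_eq_zero [Projective (M.obj s)] {N : ModuleCat.{u} (X.A s)ᵐᵒᵖ} {q : ℕ}
    (x : Ext M (bracket N) (q + 1)) : x = 0 :=
  have : Projective ((ev X s).obj M) := inferInstanceAs (Projective (M.obj s))
  ext_rightAdjoint_eq_zero (bracketAdj X s) (fun hS => bracketFunctor_shortExact hS) q x

attribute [local instance] Abelian.hasFiniteBiproducts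

lemma ext_cechX_eq_zero {r : ℕ} (hM : M.IsLocallyFreeOfRank r) (N : Qcoh X) {d : ℕ}
    (e : Fin d ≃ I) {p q : ℕ} (x : Ext M (N.cechX e p) (q + 1)) : x = 0 := by
  have h := biproduct.total (f := fun J : Fin (p + 1) ↪o Fin d => bracket (N.obj (inter e J)))
  have h' : x = x.comp (∑ J : Fin (p + 1) ↪o Fin d, Ext.mk₀ (N.cechπ e J ≫
      biproduct.ι (fun J : Fin (p + 1) ↪o Fin d => bracket (N.obj (inter e J))) J))
      (add_zero _) := by
    rw [← Ext.mk₀_sum]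
    exact (Ext.comp_mk₀_id x).symm.trans
      (congrArg (fun f => x.comp (Ext.mk₀ f) (add_zero _)) h.symm)
  rw [h', Ext.comp_sum]
  refine Finset.sum_eq_zero fun J _ => ?_
  have := hM.projective (inter e J)
  rw [← Ext.mk₀_comp_mk₀, ← Ext.comp_assoc_of_second_deg_zero]
  exact (congrArg (fun y => Ext.comp y _ _) (ext_bracket_eq_zero _)).trans (Ext.zero_comp ..)

end

end Qcoh

end NC

theorem corollary4p6 {k : Type t} [Field k] {I : Type w} [SemilatticeInf I]
    (X : NC.NCScheme.{w, u, t} k I) [X.HasInter] {d : ℕ} (e : Fin d ≃ I)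
    [CategoryTheory.HasExt.{v} (NC.Qcoh X)] (M N : NC.Qcoh X) :
    (∃ (E : CategoryTheory.CohomologicalSpectralSequenceNat (ModuleCat.{v} k) 1)
      (iso : ∀ p q : ℕ, (E.page 1).X (p, q) ≃ₗ[k]
        CategoryTheory.Abelian.Ext M ((N.cech e).X p) q),
      (∀ (p q : ℕ) (x : (E.page 1).X (p, q)),
        iso (p + 1) q ((E.page 1).d (p, q) (p + 1, q) x) =
          (iso p q x).comp (CategoryTheory.Abelian.Ext.mk₀ ((N.cech e).d p (p + 1)))
            (add_zero q)) ∧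
      Nonempty (NC.ConvergesTo E (fun n => CategoryTheory.Abelian.Ext M N n))) ∧
    ((∃ r : ℕ, M.IsLocallyFreeOfRank r) →
      ∀ p : ℕ, Nonempty ((NC.Qcoh.homCech e M N).homology p ≃ₗ[k]
        CategoryTheory.Abelian.Ext M N p)) := by
  let R := N.cechResolution e
  refine ⟨⟨(R.exactCouple k M).spectralSequence, (R.exactCouple k M).firstPageEquiv _,
    fun p q x => ((R.exactCouple k M).firstPageEquiv_d _ x).trans
      (R.exactCouple_j_del k M p q _),
    ⟨(R.exactCouple k M).convergesTo⟩⟩, fun ⟨r, hM⟩ p => ?_⟩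
  exact R.nonempty_homology_equiv k M
    (fun p q x => NC.Qcoh.ext_cechX_eq_zero hM N e x) p
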